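/- Let $D=D_1\#D_2\#\cdots\#D_n$ ($n\ge 1$) be a connected sum of diagrams of unoriented links on the sphere, formed by attaching $D_2,\dots,D_n$ one after the other: $D_{i+1}$ is attached to $D_1\#\cdots\#D_i$ by cutting an arbitrary edge of each of the two diagrams and joining the ends in pairs. Suppose that every $D_i$ is a reduced alternating diagram of a prime (in particular non-empty, non-split and non-trivial) link. An arc of $D$ runs from an undercrossing to the next one (or is a closed curve without undercrossings). A Fox $k$-coloring of $D$ is a map $f:\mathrm{arcs}(D)\to\mathbb Z_k$ with $2f(b)-f(a)-f(c)=0$ at every crossing with over-arc $b$ and under-arcs $a,c$. Let $Col(D)$ be the abelian group generated by the arcs of $D$ with one relation $2b-a-c=0$ for each crossing, and let $Col^{red}(D)=Col(D)/\langle a_0\rangle$, where $a_0$ is any chosen base arc. Each attachment of a summand produces a pair of joining arcs, namely the arcs of $D$ that contain the two ends of the edge of $D_1\#\cdots\#D_i$ that was cut to attach $D_{i+1}$. Let $\sim$ be the equivalence relation on the arcs of $D$ generated by these pairs. (If no arc of $D$ belongs to two of these pairs, then $x\sim y$ for $x\ne y$ means exactly that $x,y$ are the two arcs joining some $D_{i+1}$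 to the preceding summands; in any case $x\sim y$ with $x\neq y$ only if both $x$ and $y$ are joining arcs.) Then $Col^{red}(D)$ is finite, and if $Col^{red}(D)\cong\mathbb Z_{n_1}\oplus\mathbb Z_{n_2}\oplus\cdots\oplus\mathbb Z_{n_s}$ with all $n_i>1$ and $n_{i+1}\mid n_i$, then $s\ge 1$ and: (a) for any two arcs $x\not\sim y$ of $D$ there is a Fox $n_1$-coloring $f$ of $D$ with $f(x)\ne f(y)$; (b) there are $t\le s$ Fox $n_1$-colorings $f_1,\dots,f_t$ of $D$ such that for any two arcs $x\not\sim y$ of $D$ there is a $k$ with $f_k(x)\neq f_k(y)$. -/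

import Mathlib

/-!
Link diagrams on the two-sphere, encoded by planar diagram codes, up to Reidemeister moves;
Fox colorings; connected sums of diagrams.
-/

/-- The four half-edges (darts) at each crossing of a set `X` of crossings. The second component is
the position of the dart in the counterclockwise order around its crossing; the positions `0`, `2`
are the two ends of the under-strand, the positions `1`, `3` the two ends of the over-strand. -/
abbrev Dart (X : Type) : Type := X × ZMod 4

/-- The permutation of the darts whose cycles are the faces (the regions of the sphere), for an edge
involution `edge`: walk along a dart to its other end and turn as far to the left as possible. The
cycle of `(x, i)` is the face to the left of the dart `(x, i)`, that is, the face that contains the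
corner at `x` between the positions `i` and `i + 1`. -/
def facePerm {X : Type} (edge : Equiv.Perm (Dart X)) : Equiv.Perm (Dart X) :=
  edge.trans ((Equiv.refl X).prodCongr (Equiv.subRight (1 : ZMod 4)))

/-- Two crossings are adjacent if some edge runs from one to the other. -/
def CrossingAdj {X : Type} (edge : Equiv.Perm (Dart X)) (x y : X) : Prop :=
  ∃ i j : ZMod 4, edge (x, i) = (y, j)

/-- The connected pieces, containing a crossing, of the underlying 4-valent graph. -/
abbrev CrossingPieces {X : Type} (edge : Equiv.Perm (Dart X)) : Type := Quot (CrossingAdj edge)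

/-- The number of faces, counted separately for every connected piece of the diagram. -/
noncomputable def faceCount {X : Type} (edge : Equiv.Perm (Dart X)) : ℕ :=
  Nat.card (Quotient (Equiv.Perm.SameCycle.setoid (facePerm edge)))

/-- An unoriented link diagram on the sphere: finitely many crossings, an involution without fixed
points that joins the darts in pairs to form the edges, and a number of crossingless closed curves.
Planarity is Euler's formula `V - E + F = 2 c` with `V` crossings, `E = 2 V` edges and `c` connected
pieces. The position of different connected pieces relative to each other is not recorded; it does
not affect the link. -/
structure LinkDiagram where
  Crossing : Type
  [finite_crossing : Finite Crossing]
  edge : Equiv.Perm (Dart Crossing)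
  edge_edge : ∀ d, edge (edge d) = d
  edge_ne : ∀ d, edge d ≠ d
  loops : ℕ
  planar : faceCount edge = Nat.card Crossing + 2 * Nat.card (CrossingPieces edge)

namespace LinkDiagram

attribute [instance] LinkDiagram.finite_crossing

/-- The dart is an end of an over-strand. -/
def IsOver {X : Type} (d : Dart X) : Prop := d.2 = 1 ∨ d.2 = 3

/-- The darts `a` and `b` have the same face on their left. -/
def SameFace (D : LinkDiagram) (a b : Dart D.Crossing) : Prop :=
  (facePerm D.edge).SameCycle a b

/-- The number of connected pieces of the diagram, as a subset of the sphere. -/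
noncomputable def numPieces (D : LinkDiagram) : ℕ :=
  Nat.card (CrossingPieces D.edge) + D.loops

/-- Along every component, over- and undercrossings alternate: each edge is at one end part of
an over-strand and at the other end part of an under-strand. -/
def Alternating (D : LinkDiagram) : Prop :=
  ∀ d : Dart D.Crossing, IsOver (D.edge d) ↔ ¬ IsOver d

/-- No crossing is nugatory: at no crossing do two opposite corners belong to the same face. -/
def Reduced (D : LinkDiagram) : Prop :=
  ∀ (x : D.Crossing) (i : ZMod 4), ¬ D.SameFace (x, i) (x, i + 2)

/-! ### Arcs and Fox colorings -/

/-- Darts that follow each other directly on an arc: the two ends of an edge, and the two ends of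
the over-strand at a crossing. -/
inductive ArcStep (D : LinkDiagram) : Dart D.Crossing → Dart D.Crossing → Prop
  | edge (d : Dart D.Crossing) : ArcStep D d (D.edge d)
  | over (x : D.Crossing) : ArcStep D (x, 1) (x, 3)

/-- The arcs of a diagram: the maximal parts that run from undercrossing to undercrossing without
passing under in between, and the closed curves that never pass under, among them the crossingless
ones. -/
abbrev Arc (D : LinkDiagram) : Type := Quot (ArcStep D) ⊕ Fin D.loops

/-- The arc that contains a dart. -/
def arc (D : LinkDiagram) (d : Dart D.Crossing) : Arc D := Sum.inl (Quot.mk _ d)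

/-- A Fox `k`-coloring: at each crossing, twice the color of the over-arc is the sum of the colors
of the two under-arcs. -/
def IsFoxColoring (D : LinkDiagram) (k : ℕ) (f : Arc D → ZMod k) : Prop :=
  ∀ x : D.Crossing, 2 * f (D.arc (x, 1)) - f (D.arc (x, 0)) - f (D.arc (x, 2)) = 0

/-- The relator `2 b - a - c` of a crossing with over-arc `b` and under-arcs `a`, `c`. -/
noncomputable def colRelator (D : LinkDiagram) (x : D.Crossing) : Arc D →₀ ℤ :=
  Finsupp.single (D.arc (x, 1)) 2 - Finsupp.single (D.arc (x, 0)) 1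
    - Finsupp.single (D.arc (x, 2)) 1

/-- The universal group of Fox colorings: the abelian group generated by the arcs with the relation
`2 b - a - c = 0` for each crossing. -/
abbrev Col (D : LinkDiagram) : Type :=
  (Arc D →₀ ℤ) ⧸ Submodule.span ℤ (Set.range (colRelator D))

/-- The element of the universal group that an arc represents. -/
noncomputable def colArc (D : LinkDiagram) (a : Arc D) : Col D :=
  Submodule.Quotient.mk (Finsupp.single a 1)

/-- The reduced group of Fox colorings: the quotient of the universal group by the infinite cyclic
group generated by a base arc. Its isomorphism type does not depend on the base arc. -/
abbrev ColRed (D : LinkDiagram) (base : Arc D) : Type :=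
  Col D ⧸ Submodule.span ℤ {colArc D base}

/-! ### Reidemeister moves -/

/-- `D₂` is `D₁` with relabelled crossings. A half turn of a crossing keeps the under-strand. -/
def IsIso (D₁ D₂ : LinkDiagram) : Prop :=
  ∃ (f : D₁.Crossing ≃ D₂.Crossing) (r : D₁.Crossing → ZMod 4),
    (∀ x, r x = 0 ∨ r x = 2) ∧
    (∀ x i y j, D₁.edge (x, i) = (y, j) → D₂.edge (f x, i + r x) = (f y, j + r y)) ∧
    D₂.loops = D₁.loops

/-- First Reidemeister move: `D₂` is `D₁` with a kink, whose crossing is `c`, inserted into the edge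
with the ends `h` and `D₁.edge h`. The position `i` decides which strand of the kink is over. -/
def IsR1 (D₁ D₂ : LinkDiagram) : Prop :=
  ∃ (f : D₁.Crossing ⊕ Unit ≃ D₂.Crossing) (h : Dart D₁.Crossing) (i : ZMod 4),
    let old : Dart D₁.Crossing → Dart D₂.Crossing := fun m => (f (Sum.inl m.1), m.2)
    let c : D₂.Crossing := f (Sum.inr ())
    D₂.edge (c, i) = (c, i + 1) ∧
    D₂.edge (old h) = (c, i + 2) ∧
    D₂.edge (old (D₁.edge h)) = (c, i + 3) ∧
    (∀ m, m ≠ h → m ≠ D₁.edge h → D₂.edge (old m) = old (D₁.edge m)) ∧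
    D₂.loops = D₁.loops

/-- First Reidemeister move on a crossingless closed curve of `D₁`, which becomes in `D₂` a closed
curve with one crossing `c`. -/
def IsR1Loop (D₁ D₂ : LinkDiagram) : Prop :=
  ∃ (f : D₁.Crossing ⊕ Unit ≃ D₂.Crossing) (i : ZMod 4),
    let old : Dart D₁.Crossing → Dart D₂.Crossing := fun m => (f (Sum.inl m.1), m.2)
    let c : D₂.Crossing := f (Sum.inr ())
    D₂.edge (c, i) = (c, i + 1) ∧
    D₂.edge (c, i + 2) = (c, i + 3) ∧
    (∀ m, D₂.edge (old m) = old (D₁.edge m)) ∧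
    D₁.loops = D₂.loops + 1

/-- Second Reidemeister move: two different edges, those of the darts `h` and `k`, lie on a common
face to their left (or on different connected pieces, which can be placed so). In `D₂` the edge
of `h` has been pushed through that face across the edge of `k`, above it or below it according
to `i`, with the new crossings `c` and `d`. The edge of `h` now runs through `c` and then `d`,
the edge of `k` through `d` and then `c`. -/
def IsR2 (D₁ D₂ : LinkDiagram) : Prop :=
  ∃ (f : D₁.Crossing ⊕ Bool ≃ D₂.Crossing) (h k : Dart D₁.Crossing) (i : ZMod 4),
    let old : Dart D₁.Crossing → Dart D₂.Crossing := fun m => (f (Sum.inl m.1), m.2)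
    let c : D₂.Crossing := f (Sum.inr false)
    let d : D₂.Crossing := f (Sum.inr true)
    k ≠ h ∧ k ≠ D₁.edge h ∧
    (D₁.SameFace h k ∨
      Quot.mk (CrossingAdj D₁.edge) h.1 ≠ Quot.mk (CrossingAdj D₁.edge) k.1) ∧
    D₂.edge (old h) = (c, i) ∧
    D₂.edge (c, i + 2) = (d, i + 2) ∧
    D₂.edge (d, i) = old (D₁.edge h) ∧
    D₂.edge (old k) = (d, i + 1) ∧
    D₂.edge (d, i + 3) = (c, i + 1) ∧
    D₂.edge (c, i + 3) = old (D₁.edge k) ∧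
    (∀ m, m ≠ h → m ≠ D₁.edge h → m ≠ k → m ≠ D₁.edge k → D₂.edge (old m) = old (D₁.edge m)) ∧
    D₂.loops = D₁.loops

open Classical in
/-- Third Reidemeister move: the crossings `x`, `y`, `z` are the corners of a triangular face, and
the strand through `x` and `y` is over at both. In `D₂` each of the three strands runs through
its two crossings in the opposite order. If `p` at one crossing and `q` at the next are the ends
of a side of the triangle and `p₂`, `q₂` are the darts opposite to them, this exchanges `p` with
`q₂` and `q` with `p₂`. -/
def IsR3 (D₁ D₂ : LinkDiagram) : Prop :=
  ∃ (f : D₁.Crossing ≃ D₂.Crossing) (x y z : D₁.Crossing) (i j k : ZMod 4),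
    let new : Dart D₁.Crossing → Dart D₂.Crossing := fun m => (f m.1, m.2)
    let side : Dart D₁.Crossing → Dart D₁.Crossing → Equiv.Perm (Dart D₁.Crossing) :=
      fun p q => Equiv.swap p (q.1, q.2 + 2) * Equiv.swap q (p.1, p.2 + 2)
    let exch : Equiv.Perm (Dart D₁.Crossing) :=
      side (x, i) (y, j + 1) * side (y, j) (z, k + 1) * side (z, k) (x, i + 1)
    x ≠ y ∧ y ≠ z ∧ z ≠ x ∧
    D₁.edge (x, i) = (y, j + 1) ∧
    D₁.edge (y, j) = (z, k + 1) ∧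
    D₁.edge (z, k) = (x, i + 1) ∧
    (i = 1 ∨ i = 3) ∧ (j = 0 ∨ j = 2) ∧
    (∀ m, D₂.edge (new (exch m)) = new (exch (D₁.edge m))) ∧
    D₂.loops = D₁.loops

/-- Two diagrams represent the same link: they are connected by a finite sequence of Reidemeister
moves, their inverses, and relabellings. -/
def SameLink : LinkDiagram → LinkDiagram → Prop :=
  Relation.EqvGen fun D₁ D₂ =>
    IsIso D₁ D₂ ∨ IsR1 D₁ D₂ ∨ IsR1Loop D₁ D₂ ∨ IsR2 D₁ D₂ ∨ IsR3 D₁ D₂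

/-- The crossingless diagram that consists of one circle. -/
def circle : LinkDiagram where
  Crossing := Empty
  edge := Equiv.refl _
  edge_edge := fun _ => rfl
  edge_ne := fun d => d.1.elim
  loops := 1
  planar := by
    have h₁ : IsEmpty (Quotient (Equiv.Perm.SameCycle.setoid
        (facePerm (Equiv.refl (Dart Empty))))) :=
      ⟨fun q => Quotient.inductionOn q fun d => d.1.elim⟩
    have h₂ : IsEmpty (CrossingPieces (Equiv.refl (Dart Empty))) :=
      ⟨fun q => Quot.inductionOn q fun x => x.elim⟩
    simp [faceCount]

/-- The diagram represents the unknot. -/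
def IsUnknot (D : LinkDiagram) : Prop := SameLink D circle

/-! ### Connected sums and prime links -/

/-- `D` is the connected sum of `D₁` and `D₂`, with crossings identified by `f`: the edge with the
ends `h₁`, `D₁.edge h₁` and the edge with the ends `h₂`, `D₂.edge h₂` are cut, and `h₁` is joined
with `h₂` and `D₁.edge h₁` with `D₂.edge h₂`. -/
def IsSum (D₁ D₂ : LinkDiagram) (h₁ : Dart D₁.Crossing) (h₂ : Dart D₂.Crossing)
    (D : LinkDiagram) (f : D₁.Crossing ⊕ D₂.Crossing ≃ D.Crossing) : Prop :=
  let left : Dart D₁.Crossing → Dart D.Crossing := fun m => (f (Sum.inl m.1), m.2)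
  let right : Dart D₂.Crossing → Dart D.Crossing := fun m => (f (Sum.inr m.1), m.2)
  D.edge (left h₁) = right h₂ ∧
  D.edge (left (D₁.edge h₁)) = right (D₂.edge h₂) ∧
  (∀ m, m ≠ h₁ → m ≠ D₁.edge h₁ → D.edge (left m) = left (D₁.edge m)) ∧
  (∀ m, m ≠ h₂ → m ≠ D₂.edge h₂ → D.edge (right m) = right (D₂.edge m)) ∧
  D.loops = D₁.loops + D₂.loops

/-- The diagram represents a prime link: the link is non-empty, not split (it has no disconnected
diagram), not the unknot, and whenever it is a connected sum of two links, one of them is the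
unknot. -/
structure RepresentsPrimeLink (D : LinkDiagram) : Prop where
  nonempty : 0 < D.numPieces
  not_split : ∀ E : LinkDiagram, SameLink D E → ¬ 1 < E.numPieces
  not_unknot : ¬ IsUnknot D
  indecomposable : ∀ (D₁ D₂ : LinkDiagram) (h₁ : Dart D₁.Crossing) (h₂ : Dart D₂.Crossing)
    (E : LinkDiagram) (f : D₁.Crossing ⊕ D₂.Crossing ≃ E.Crossing),
    SameLink D E → IsSum D₁ D₂ h₁ h₂ E f → IsUnknot D₁ ∨ IsUnknot D₂

/-- `IsConnectedSum [D₁, …, Dₙ] D J`: the diagram `D` is a connected sum `D₁ # … # Dₙ`, formed one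
summand after the other along arbitrary edges. The relation `J` records the pairs of joining arcs:
whenever a summand was attached at an edge with the ends `h` and `edge h`, the dart `h` lies on
one of the two joining arcs, the dart `edge h` on the other, and `J` relates these two darts. -/
inductive IsConnectedSum : List LinkDiagram → (D : LinkDiagram) →
    (Dart D.Crossing → Dart D.Crossing → Prop) → Prop
  | single (D : LinkDiagram) : IsConnectedSum [D] D (fun _ _ => False)
  | sum {L : List LinkDiagram} {D₁ : LinkDiagram}
      {J : Dart D₁.Crossing → Dart D₁.Crossing → Prop}
      (hL : IsConnectedSum L D₁ J) (D₂ : LinkDiagram)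
      (h₁ : Dart D₁.Crossing) (h₂ : Dart D₂.Crossing) (D : LinkDiagram)
      (f : D₁.Crossing ⊕ D₂.Crossing ≃ D.Crossing) (hD : IsSum D₁ D₂ h₁ h₂ D f) :
      IsConnectedSum (L ++ [D₂]) D (fun a b => ∃ a₁ b₁ : Dart D₁.Crossing,
        (J a₁ b₁ ∨ (a₁ = h₁ ∧ b₁ = D₁.edge h₁)) ∧
        a = (f (Sum.inl a₁.1), a₁.2) ∧ b = (f (Sum.inl b₁.1), b₁.2))

/-- Two arcs are equal or are joining arcs of the same place: the equivalence relation generated by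
the pairs of joining arcs. If all summands are attached at different arcs, then it relates, apart
from equal arcs, only the two arcs that join one summand with the next. -/
def JoinEquiv (D : LinkDiagram) (J : Dart D.Crossing → Dart D.Crossing → Prop) :
    Arc D → Arc D → Prop :=
  Relation.EqvGen fun x y => ∃ a b, J a b ∧ x = D.arc a ∧ y = D.arc b

end LinkDiagram

/-! Two arcs have the same color in all colorings with values in abelian groups exactly when they
have the same class in `Col D`. Passing to `ColRed` identifies no further arcs, because every arc
has degree one. It is therefore enough that arcs with equal classes are related by `JoinEquiv`: the
coordinates of the given decomposition, followed by embeddings of each Z_{n_i} into Z_{n_1}, are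
then the required colorings.

The core is a maximum principle for a connected alternating diagram (`exists_isCut_of_colArc_eq`).
Its arcs correspond to crossings, each arc to the crossing where it is over. If the arcs of
crossings x ≠ y have the same class, their difference is an integer combination of relators. Its
coefficients v satisfy: 2v(c) minus the values of v at the two ends of the over-arc of c equals
δ_x(c) - δ_y(c). The set where v is maximal is then left by exactly one over dart, at x. Over and
under darts being equally many, it is left by exactly one under dart as well. The two edges form a
cut that displays the diagram as a connected sum.

Both sides of the cut are reduced and alternating, and planar by an Euler characteristic count
(`faceCount_restrict`). By induction along such cuts, each side has a nonconstant coloring, which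
the unknot has not, by Reidemeister invariance of the number of colorings. Neither side is an
unknot, so a prime link admits no such cut (`RepresentsPrimeLink.arc_eq`).

Colorings of one summand extend by a constant over the other, so two arcs of a connected sum can be
inseparable only through the joining arcs (`IsConnectedSum.colorings`). Finiteness of `ColRed`
follows from a second maximum principle: integer colorings are constant, on each summand and hence
on the sum. -/

namespace LinkDiagram

/-! ### Cuts of the underlying graph -/

/-- A set of crossings that is closed under adjacency and contains a crossing contains them all. -/
def IsConnectedMap {X : Type} (edge : Equiv.Perm (Dart X)) : Prop :=
  ∀ S : Set X, S.Nonempty → (∀ d : Dart X, d.1 ∈ S → (edge d).1 ∈ S) → S = Set.univ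

/-- Exactly two edges leave the set `M` of crossings, at the darts `p` and `s` of `M`, one of them
over and the other one under. -/
structure IsCut {X : Type} (edge : Equiv.Perm (Dart X)) (M : Set X) (p s : Dart X) : Prop where
  left_mem : p.1 ∈ M
  right_mem : s.1 ∈ M
  isOver_iff : IsOver p ↔ ¬ IsOver s
  edge_mem : ∀ d : Dart X, d.1 ∈ M → ((edge d).1 ∈ M ↔ d ≠ p ∧ d ≠ s)

theorem isOver_add_one {X : Type} (x : X) (i : ZMod 4) : IsOver (x, i + 1) ↔ ¬ IsOver (x, i) := by
  unfold IsOver; dsimp only; revert i; decide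

theorem isOver_sub_one {X : Type} (x : X) (i : ZMod 4) : IsOver (x, i - 1) ↔ ¬ IsOver (x, i) := by
  unfold IsOver; dsimp only; revert i; decide

/-! ### Counting over and under darts. -/

section Parity

variable {X : Type} {edge : Equiv.Perm (Dart X)} {Q : Dart X → Prop}

/-- Turning each dart by one position around its crossing exchanges the two parities. -/
theorem ncard_parity (hQ : ∀ x i, Q (x, i + 1) ↔ ¬ Q (x, i)) (M : Set X) :
    {d : Dart X | d.1 ∈ M ∧ ¬ Q d}.ncard = {d : Dart X | d.1 ∈ M ∧ Q d}.ncard := by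
  rw [← Set.ncard_image_of_injective {d : Dart X | d.1 ∈ M ∧ Q d}
    (f := fun d : Dart X => (d.1, d.2 + 1))]
  · congr 1
    ext ⟨x, i⟩
    constructor
    · rintro ⟨hx, hi⟩
      refine ⟨(x, i - 1), ⟨hx, ?_⟩, by simp⟩
      have := hQ x (i - 1)
      rw [sub_add_cancel] at this
      tauto
    · rintro ⟨⟨y, j⟩, ⟨hy, hj⟩, h⟩
      simp only [Prod.mk.injEq] at h
      obtain ⟨rfl, rfl⟩ := h
      exact ⟨hy, fun h => (hQ _ _).1 h hj⟩
  · rintro ⟨x, i⟩ ⟨y, j⟩ h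
    simpa using h

/-- `edge` maps the darts of `M` with `Q` injectively into those without `Q`. The two sets have
equal size, so the map is onto, and the darts without `Q` stay in `M` too. -/
theorem edge_mem_of_parity [Finite X] (hQ : ∀ x i, Q (x, i + 1) ↔ ¬ Q (x, i))
    (hedge : ∀ d, edge (edge d) = d) (halt : ∀ d, Q (edge d) ↔ ¬ Q d) (M : Set X)
    (hM : ∀ d : Dart X, d.1 ∈ M → Q d → (edge d).1 ∈ M) (d : Dart X) (hd : d.1 ∈ M) :
    (edge d).1 ∈ M := by
  by_cases hq : Q d
  · exact hM d hd hq
  have hsub : edge '' {d : Dart X | d.1 ∈ M ∧ Q d} ⊆ {d : Dart X | d.1 ∈ M ∧ ¬ Q d} := by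
    rintro _ ⟨d, ⟨h1, h2⟩, rfl⟩
    exact ⟨hM d h1 h2, fun h => (halt d).1 h h2⟩
  have heq := Set.eq_of_subset_of_ncard_le hsub (by
    rw [Set.ncard_image_of_injective _ edge.injective, ncard_parity hQ])
  have : d ∈ edge '' {d : Dart X | d.1 ∈ M ∧ Q d} := by rw [heq]; exact ⟨hd, hq⟩
  obtain ⟨c, hc, rfl⟩ := this
  rw [hedge]; exact hc.1

/-- The same count with one exception: when a single dart with `Q` leaves `M`, exactly one dart
without `Q` is not reached from inside `M`, and it is the other exit. -/
theorem exists_unique_exit [Finite X] (hQ : ∀ x i, Q (x, i + 1) ↔ ¬ Q (x, i))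
    (hedge : ∀ d, edge (edge d) = d) (halt : ∀ d, Q (edge d) ↔ ¬ Q d) (M : Set X)
    (p : Dart X) (hp : p.1 ∈ M) (hQp : Q p) (hpM : (edge p).1 ∉ M)
    (hM : ∀ d : Dart X, d.1 ∈ M → Q d → d ≠ p → (edge d).1 ∈ M) :
    ∃ s : Dart X, s.1 ∈ M ∧ ¬ Q s ∧ ∀ d : Dart X, d.1 ∈ M → ((edge d).1 ∈ M ↔ d ≠ p ∧ d ≠ s) := by
  set A : Set (Dart X) := {d | d.1 ∈ M ∧ Q d} with hA
  set B : Set (Dart X) := {d | d.1 ∈ M ∧ ¬ Q d} with hB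
  have hsub : edge '' (A \ {p}) ⊆ B := by
    rintro _ ⟨d, ⟨⟨h1, h2⟩, h3⟩, rfl⟩
    exact ⟨hM d h1 h2 h3, fun h => (halt d).1 h h2⟩
  have hone : (B \ edge '' (A \ {p})).ncard = 1 := by
    have hpA : p ∈ A := ⟨hp, hQp⟩
    rw [Set.ncard_sdiff hsub, Set.ncard_image_of_injective _ edge.injective,
      Set.ncard_sdiff_singleton_of_mem hpA, hA, hB, ncard_parity hQ]
    have : 0 < A.ncard := (Set.ncard_pos).2 ⟨p, hpA⟩
    rw [hA] at this
    omega
  obtain ⟨s, hs⟩ := Set.ncard_eq_one.1 hone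
  have hsm : s ∈ B \ edge '' (A \ {p}) := by rw [hs]; rfl
  refine ⟨s, hsm.1.1, hsm.1.2, fun d hd => ⟨fun h => ⟨?_, ?_⟩, fun ⟨h1, h2⟩ => ?_⟩⟩
  · rintro rfl; exact hpM h
  · rintro rfl
    refine hsm.2 ⟨edge d, ⟨⟨h, (halt d).2 hsm.1.2⟩, ?_⟩, hedge d⟩
    rintro hdp
    rw [Set.mem_singleton_iff] at hdp
    exact hpM (by rw [← hdp, hedge]; exact hd)
  · by_cases hq : Q d
    · exact hM d hd hq h1
    · by_contra hn
      refine h2 ?_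
      have : d ∈ B \ edge '' (A \ {p}) := by
        refine ⟨⟨hd, hq⟩, ?_⟩
        rintro ⟨c, hc, rfl⟩
        exact hn (by rw [hedge]; exact hc.1.1)
      rw [hs] at this; exact this

end Parity

/-- The closed-set form of connectedness suits the maximum principles; the number of pieces enters
Euler's formula. -/
theorem isConnectedMap_iff {X : Type} [Nonempty X] {edge : Equiv.Perm (Dart X)}
    (hedge : ∀ d, edge (edge d) = d) :
    IsConnectedMap edge ↔ Nat.card (CrossingPieces edge) = 1 := by
  constructor
  · intro h
    rw [Nat.card_eq_one_iff_unique]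
    refine ⟨⟨?_⟩, ⟨Quot.mk _ (Classical.arbitrary X)⟩⟩
    rintro ⟨x⟩ ⟨y⟩
    have := h {z | Quot.mk (CrossingAdj edge) z = Quot.mk _ x} ⟨x, rfl⟩ (by
      rintro d hd
      rw [Set.mem_ofPred_eq] at hd ⊢
      rw [← hd]
      exact (Quot.sound ⟨d.2, (edge d).2, rfl⟩).symm)
    have hy : y ∈ {z | Quot.mk (CrossingAdj edge) z = Quot.mk _ x} := by rw [this]; trivial
    exact hy.symm
  · intro h S ⟨x, hx⟩ hS
    rw [Nat.card_eq_one_iff_unique] at h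
    obtain ⟨h, -⟩ := h
    ext y
    simp only [Set.mem_univ, iff_true]
    have hxy : Quot.mk (CrossingAdj edge) x = Quot.mk (CrossingAdj edge) y := Subsingleton.elim _ _
    have key : ∀ a b, CrossingAdj edge a b → (a ∈ S ↔ b ∈ S) := by
      rintro a b ⟨i, j, hij⟩
      constructor
      · intro ha
        have := hS (a, i) ha
        rwa [hij] at this
      · intro hb
        have := hS (b, j) hb
        rwa [← hij, hedge] at this
    have := congrArg (Quot.lift (fun z => z ∈ S) (fun a b hab => propext (key a b hab))) hxy
    exact this.mp hx

/-- A dart at a crossing of `M`, as a dart of the whole diagram. -/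
def dartIncl {X : Type} (M : Set X) (d : Dart M) : Dart X := (d.1, d.2)

theorem dartIncl_injective {X : Type} (M : Set X) : Function.Injective (dartIncl M) := by
  rintro ⟨x, i⟩ ⟨y, j⟩ h
  simp only [dartIncl, Prod.mk.injEq] at h
  exact Prod.ext (Subtype.ext h.1) h.2

theorem isOver_dartIncl {X : Type} (M : Set X) (d : Dart M) : IsOver (dartIncl M d) ↔ IsOver d :=
  Iff.rfl

namespace IsCut

variable {X : Type} {edge : Equiv.Perm (Dart X)} {M : Set X} {p s : Dart X}

theorem ne (h : IsCut edge M p s) : p ≠ s := by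
  rintro rfl
  have := h.isOver_iff
  tauto

theorem symm (h : IsCut edge M p s) : IsCut edge M s p :=
  ⟨h.right_mem, h.left_mem, by rw [h.isOver_iff, not_not],
    fun d hd => by rw [h.edge_mem d hd, and_comm]⟩

theorem edge_left_notMem (h : IsCut edge M p s) : (edge p).1 ∉ M := fun hp =>
  ((h.edge_mem p h.left_mem).1 hp).1 rfl

/-- The ends change order because `edge s`, not `edge p`, has the parity of `p`; this is also the
dart that shares a face with `p`. -/
theorem compl (h : IsCut edge M p s) (hedge : ∀ d, edge (edge d) = d)
    (halt : ∀ d, IsOver (edge d) ↔ ¬ IsOver d) : IsCut edge Mᶜ (edge s) (edge p) := by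
  refine ⟨h.symm.edge_left_notMem, h.edge_left_notMem, ?_, fun d hd => ?_⟩
  · rw [halt, halt]; have := h.isOver_iff; tauto
  · constructor
    · intro hed
      refine ⟨?_, ?_⟩
      · rintro rfl
        rw [hedge] at hed
        exact hed h.right_mem
      · rintro rfl
        rw [hedge] at hed
        exact hed h.left_mem
    · rintro ⟨h1, h2⟩ hed
      refine hd ?_
      have := (h.edge_mem (edge d) hed).2 ⟨?_, ?_⟩
      · rwa [hedge] at this
      · rintro rfl; exact h2 (hedge d).symm
      · rintro rfl; exact h1 (hedge d).symm

open Classical in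
/-- The edges of the part `M` of a diagram after the two edges that leave `M` have been cut and
their ends in `M` have been joined. -/
noncomputable def restrictFun (h : IsCut edge M p s) (d : Dart M) : Dart M :=
  if h₁ : dartIncl M d = p then (⟨s.1, h.right_mem⟩, s.2)
  else if h₂ : dartIncl M d = s then (⟨p.1, h.left_mem⟩, p.2)
  else (⟨(edge (dartIncl M d)).1, (h.edge_mem _ d.1.2).2 ⟨h₁, h₂⟩⟩, (edge (dartIncl M d)).2)

theorem restrictFun_left (h : IsCut edge M p s) {d : Dart M} (hd : dartIncl M d = p) :
    dartIncl M (h.restrictFun d) = s := by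
  rw [restrictFun, dif_pos hd]; rfl

theorem restrictFun_right (h : IsCut edge M p s) {d : Dart M} (hd : dartIncl M d = s) :
    dartIncl M (h.restrictFun d) = p := by
  rw [restrictFun, dif_neg (by rw [hd]; exact h.ne.symm), dif_pos hd]; rfl

theorem restrictFun_of_ne (h : IsCut edge M p s) {d : Dart M} (h₁ : dartIncl M d ≠ p)
    (h₂ : dartIncl M d ≠ s) : dartIncl M (h.restrictFun d) = edge (dartIncl M d) := by
  rw [restrictFun, dif_neg h₁, dif_neg h₂]; rfl

theorem restrictFun_restrictFun (h : IsCut edge M p s) (hedge : ∀ d, edge (edge d) = d)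
    (d : Dart M) : h.restrictFun (h.restrictFun d) = d := by
  apply dartIncl_injective
  by_cases h₁ : dartIncl M d = p
  · rw [h.restrictFun_right (h.restrictFun_left h₁), h₁]
  by_cases h₂ : dartIncl M d = s
  · rw [h.restrictFun_left (h.restrictFun_right h₂), h₂]
  have hd := h.restrictFun_of_ne h₁ h₂
  rw [h.restrictFun_of_ne, hd, hedge]
  · rw [hd]
    rintro rfl
    exact h.edge_left_notMem (by rw [hedge]; exact d.1.2)
  · rw [hd]
    rintro rfl
    exact h.symm.edge_left_notMem (by rw [hedge]; exact d.1.2)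

/-- The edge involution of the part `M` of a diagram after the two edges that leave `M` have been
cut and their ends in `M` have been joined. -/
noncomputable def restrict (h : IsCut edge M p s) (hedge : ∀ d, edge (edge d) = d) :
    Equiv.Perm (Dart M) :=
  Function.Involutive.toPerm h.restrictFun (h.restrictFun_restrictFun hedge)

variable (h : IsCut edge M p s) (hedge : ∀ d, edge (edge d) = d)

theorem restrict_restrict (d : Dart M) : h.restrict hedge (h.restrict hedge d) = d :=
  h.restrictFun_restrictFun hedge d

theorem restrict_left {d : Dart M} (hd : dartIncl M d = p) :
    dartIncl M (h.restrict hedge d) = s := h.restrictFun_left hd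

theorem restrict_right {d : Dart M} (hd : dartIncl M d = s) :
    dartIncl M (h.restrict hedge d) = p := h.restrictFun_right hd

theorem restrict_of_ne {d : Dart M} (h₁ : dartIncl M d ≠ p) (h₂ : dartIncl M d ≠ s) :
    dartIncl M (h.restrict hedge d) = edge (dartIncl M d) := h.restrictFun_of_ne h₁ h₂

theorem isOver_restrict (halt : ∀ d, IsOver (edge d) ↔ ¬ IsOver d) (d : Dart M) :
    IsOver (h.restrict hedge d) ↔ ¬ IsOver d := by
  rw [← isOver_dartIncl, ← isOver_dartIncl]
  by_cases h₁ : dartIncl M d = p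
  · rw [h.restrict_left hedge h₁, h₁]
    rw [h.isOver_iff, not_not]
  by_cases h₂ : dartIncl M d = s
  · rw [h.restrict_right hedge h₂, h₂]
    exact h.isOver_iff
  rw [h.restrict_of_ne hedge h₁ h₂, halt]

/-- The new edge from `p` to `s` cannot run between a closed set and its complement. So in a
disconnection one of the two avoids both ends, and it would already be closed in the whole diagram.
-/
theorem isConnectedMap_restrict (hc : IsConnectedMap edge) :
    IsConnectedMap (h.restrict hedge) := by
  intro S hS hclosed
  by_contra hne
  -- one of `S` and its complement avoids the crossings of `p` and `s`
  have hps : (⟨p.1, h.left_mem⟩ : M) ∈ S ↔ (⟨s.1, h.right_mem⟩ : M) ∈ S := by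
    have h1 : (h.restrict hedge (⟨p.1, h.left_mem⟩, p.2)) = (⟨s.1, h.right_mem⟩, s.2) :=
      dartIncl_injective _ (h.restrict_left hedge rfl)
    have h2 : (h.restrict hedge (⟨s.1, h.right_mem⟩, s.2)) = (⟨p.1, h.left_mem⟩, p.2) :=
      dartIncl_injective _ (h.restrict_right hedge rfl)
    constructor
    · intro hp
      have := hclosed (⟨p.1, h.left_mem⟩, p.2) hp
      rwa [h1] at this
    · intro hs
      have := hclosed (⟨s.1, h.right_mem⟩, s.2) hs
      rwa [h2] at this
  have key : ∀ T : Set M, T.Nonempty → (∀ d : Dart M, d.1 ∈ T → (h.restrict hedge d).1 ∈ T) →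
      (⟨p.1, h.left_mem⟩ : M) ∈ T ∨ (⟨s.1, h.right_mem⟩ : M) ∈ T := by
    intro T ⟨y, hy⟩ hT
    by_contra hcon
    push Not at hcon
    have huniv := hc (Subtype.val '' T) ⟨y, y, hy, rfl⟩ (by
      rintro ⟨x, i⟩ ⟨x', hx', rfl⟩
      have h₁ : dartIncl M (x', i) ≠ p := by
        rintro rfl; exact hcon.1 hx'
      have h₂ : dartIncl M (x', i) ≠ s := by
        rintro rfl; exact hcon.2 hx'
      exact ⟨_, hT (x', i) hx', congrArg Prod.fst (h.restrict_of_ne hedge h₁ h₂)⟩)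
    have : p.1 ∈ Subtype.val '' T := by rw [huniv]; trivial
    obtain ⟨z, hz, hzp⟩ := this
    obtain rfl : z = ⟨p.1, h.left_mem⟩ := Subtype.ext hzp
    exact hcon.1 hz
  have k1 := key S hS hclosed
  have k2 := key Sᶜ (Set.nonempty_compl.2 hne) (by
    intro d hd hd'
    refine hd ?_
    have := hclosed _ hd'
    rwa [h.restrict_restrict hedge] at this)
  simp only [Set.mem_compl_iff] at k2
  tauto

end IsCut

/-! ### Faces -/

theorem facePerm_apply {X : Type} (edge : Equiv.Perm (Dart X)) (d : Dart X) :
    facePerm edge d = ((edge d).1, (edge d).2 - 1) := rfl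

/-- Crossing an edge changes the parity and turning by one position changes it back. This is the
checkerboard coloring: the darts of a face are all over or all under. -/
theorem isOver_facePerm {X : Type} {edge : Equiv.Perm (Dart X)}
    (halt : ∀ d, IsOver (edge d) ↔ ¬ IsOver d) (d : Dart X) :
    IsOver (facePerm edge d) ↔ IsOver d := by
  rw [facePerm_apply, isOver_sub_one, halt, not_not]

/-- In a finite cycle every element is reached by going forward, so forward closure suffices. -/
theorem mem_of_sameCycle {α : Type*} [Finite α] {φ : Equiv.Perm α} {S : Set α}
    (hS : ∀ a ∈ S, φ a ∈ S) {a b : α} (ha : a ∈ S) (hab : φ.SameCycle a b) : b ∈ S := by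
  obtain ⟨n, -, rfl⟩ := hab.exists_nat_pow_eq
  clear hab
  induction n with
  | zero => simpa using ha
  | succ n ih => rw [pow_succ', Equiv.Perm.mul_apply]; exact hS _ ih

theorem isOver_of_sameCycle {X : Type} [Finite X] {edge : Equiv.Perm (Dart X)}
    (halt : ∀ d, IsOver (edge d) ↔ ¬ IsOver d) {a b : Dart X}
    (hab : (facePerm edge).SameCycle a b) : IsOver a ↔ IsOver b := by
  have := mem_of_sameCycle (S := {d | IsOver d ↔ IsOver a})
    (fun d hd => (isOver_facePerm halt d).trans hd) Iff.rfl hab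
  exact this.symm

namespace IsCut

variable {X : Type} [Finite X] {edge : Equiv.Perm (Dart X)} {M : Set X} {p s : Dart X}

/-- The face that leaves `M` along the dart `p` returns to `M` along the dart `edge s`. -/
theorem sameCycle_left (h : IsCut edge M p s) (hedge : ∀ d, edge (edge d) = d)
    (halt : ∀ d, IsOver (edge d) ↔ ¬ IsOver d) : (facePerm edge).SameCycle p (edge s) := by
  by_contra hn
  have hc := h.compl hedge halt
  -- A face that avoids `edge s` could leave the complement only along `edge p`, whose parity is
  -- wrong. It would never return to `p`.
  have hmem := mem_of_sameCycle (φ := facePerm edge)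
    (S := {d | d.1 ∉ M ∧ (facePerm edge).SameCycle p d}) (by
      rintro d ⟨hd, hpd⟩
      refine ⟨?_, hpd.trans (Equiv.Perm.sameCycle_apply_right.2 (Equiv.Perm.SameCycle.refl _ _))⟩
      refine (hc.edge_mem d hd).2 ⟨?_, ?_⟩
      · rintro rfl; exact hn hpd
      · rintro rfl
        have := isOver_of_sameCycle halt hpd
        rw [halt] at this
        tauto)
    (a := facePerm edge p) (b := p) ⟨h.edge_left_notMem,
      (Equiv.Perm.sameCycle_apply_right.2 (Equiv.Perm.SameCycle.refl _ _))⟩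
    (Equiv.Perm.sameCycle_apply_left.2 (Equiv.Perm.SameCycle.refl _ _))
  exact hmem.1 h.left_mem

/-- A step along the new edge shortcuts an excursion of the old face through the complement of `M`;
every other step is unchanged. -/
theorem sameCycle_facePerm_restrict (h : IsCut edge M p s) (hedge : ∀ d, edge (edge d) = d)
    (halt : ∀ d, IsOver (edge d) ↔ ¬ IsOver d) (d : Dart M) :
    (facePerm edge).SameCycle (dartIncl M d)
      (dartIncl M (facePerm (h.restrict hedge) d)) := by
  have hval : dartIncl M (facePerm (h.restrict hedge) d)
    = ((dartIncl M (h.restrict hedge d)).1, (dartIncl M (h.restrict hedge d)).2 - 1) := rfl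
  have hface : ∀ c, (facePerm edge).SameCycle c ((edge c).1, (edge c).2 - 1) := fun c =>
    Equiv.Perm.sameCycle_apply_right.2 (Equiv.Perm.SameCycle.refl _ _)
  rw [hval]
  by_cases h₁ : dartIncl M d = p
  · rw [h.restrict_left hedge h₁, h₁]
    have := hface (edge s)
    rw [hedge] at this
    exact (h.sameCycle_left hedge halt).trans this
  by_cases h₂ : dartIncl M d = s
  · rw [h.restrict_right hedge h₂, h₂]
    have := hface (edge p)
    rw [hedge] at this
    exact (h.symm.sameCycle_left hedge halt).trans this
  rw [h.restrict_of_ne hedge h₁ h₂]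
  exact hface _

theorem sameCycle_of_restrict (h : IsCut edge M p s) (hedge : ∀ d, edge (edge d) = d)
    (halt : ∀ d, IsOver (edge d) ↔ ¬ IsOver d) {a b : Dart M}
    (hab : (facePerm (h.restrict hedge)).SameCycle a b) :
    (facePerm edge).SameCycle (dartIncl M a) (dartIncl M b) :=
  mem_of_sameCycle (S := {d | (facePerm edge).SameCycle (dartIncl M a) (dartIncl M d)})
    (fun d hd => Equiv.Perm.SameCycle.trans hd (h.sameCycle_facePerm_restrict hedge halt d))
    (Equiv.Perm.SameCycle.refl _ _) hab

end IsCut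

/-! ### Euler's formula for alternating diagrams -/

theorem sum_dart {X A : Type} [Fintype X] [AddCommMonoid A] (F : Dart X → A) :
    ∑ d, F d = ∑ x, (F (x, 0) + F (x, 1) + F (x, 2) + F (x, 3)) := by
  rw [Fintype.sum_prod_type]
  exact Finset.sum_congr rfl fun x _ => Fin.sum_univ_four _

theorem not_isOver_zero {X : Type} (x : X) : ¬ IsOver (x, (0 : ZMod 4)) := by
  unfold IsOver; dsimp only; decide

theorem isOver_one {X : Type} (x : X) : IsOver (x, (1 : ZMod 4)) := Or.inl rfl

theorem not_isOver_two {X : Type} (x : X) : ¬ IsOver (x, (2 : ZMod 4)) := by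
  unfold IsOver; dsimp only; decide

theorem isOver_three {X : Type} (x : X) : IsOver (x, (3 : ZMod 4)) := Or.inr rfl

open Classical in
/-- The black and the white difference functions of a function on the faces are orthogonal. -/
theorem sum_sub_mul_sub_eq_zero {X : Type} [Fintype X] {edge : Equiv.Perm (Dart X)}
    (hedge : ∀ d, edge (edge d) = d) (halt : ∀ d, IsOver (edge d) ↔ ¬ IsOver d)
    (g : Dart X → ℚ) (hg : ∀ d, g (facePerm edge d) = g d) :
    ∑ x, (g (x, 1) - g (x, 3)) * (g (x, 0) - g (x, 2)) = 0 := by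
  -- The factors are the values on the two faces beside `d`. The other end of the edge sees the same
  -- two faces with the opposite sign, so the sum over all darts vanishes.
  set F : Dart X → ℚ := fun d => (if IsOver d then 1 else -1) * (g d * g (d.1, d.2 - 1)) with hF
  have hneg : ∀ d, F (edge d) = - F d := by
    intro d
    have h1 : g ((edge d).1, (edge d).2 - 1) = g d := hg d
    have h2 : g (d.1, d.2 - 1) = g (edge d) := by
      have := hg (edge d)
      rwa [facePerm_apply, hedge] at this
    by_cases ho : IsOver d
    · simp only [hF, h1, h2, halt, ho, not_true_eq_false, if_true, if_false]; ring
    · simp only [hF, h1, h2, halt, ho, not_false_eq_true, if_true, if_false]; ring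
  have hzero : ∑ d, F d = 0 := by
    have : ∑ d, F d = - ∑ d, F d := by
      conv_lhs => rw [← Equiv.sum_comp edge F]
      rw [← Finset.sum_neg_distrib]
      exact Finset.sum_congr rfl fun d _ => hneg d
    linarith
  rw [sum_dart] at hzero
  rw [← hzero]
  refine Finset.sum_congr rfl fun x _ => ?_
  have e0 : (0 : ZMod 4) - 1 = 3 := by decide
  have e1 : (1 : ZMod 4) - 1 = 0 := by decide
  have e2 : (2 : ZMod 4) - 1 = 1 := by decide
  have e3 : (3 : ZMod 4) - 1 = 2 := by decide
  simp only [hF, not_isOver_zero, isOver_one, not_isOver_two, isOver_three, if_true, if_false,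
    e0, e1, e2, e3]
  ring

/-- Rank and nullity of the map `S`, which adds the black and the white difference at every
crossing. Its rank is at most the number of crossings. On its kernel the two differences are
opposite and orthogonal, so both vanish. A function in the kernel then has one value per face color
around each crossing, and by connectedness it is determined by two values at `x₀`. -/
theorem faceCount_le {X : Type} [Finite X] [Nonempty X] {edge : Equiv.Perm (Dart X)}
    (hedge : ∀ d, edge (edge d) = d) (halt : ∀ d, IsOver (edge d) ↔ ¬ IsOver d)
    (hc : IsConnectedMap edge) : faceCount edge ≤ Nat.card X + 2 := by
  classical
  have := Fintype.ofFinite X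
  let Face := Quotient (Equiv.Perm.SameCycle.setoid (facePerm edge))
  have : Fintype Face := Fintype.ofFinite _
  let c : Dart X → Face := Quotient.mk _
  have hcφ : ∀ d, c (facePerm edge d) = c d := fun d => Quotient.sound
    (Equiv.Perm.sameCycle_apply_left.2 (Equiv.Perm.SameCycle.refl _ _))
  let S : (Face → ℚ) →ₗ[ℚ] (X → ℚ) :=
    { toFun := fun g x => (g (c (x, 1)) - g (c (x, 3))) + (g (c (x, 0)) - g (c (x, 2)))
      map_add' := fun g g' => by funext x; simp only [Pi.add_apply]; ring
      map_smul' := fun r g => by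
        funext x; simp only [Pi.smul_apply, smul_eq_mul, RingHom.id_apply]; ring }
  let x₀ : X := Classical.arbitrary X
  let R : (Face → ℚ) →ₗ[ℚ] (Fin 2 → ℚ) :=
    { toFun := fun g => ![g (c (x₀, 0)), g (c (x₀, 1))]
      map_add' := fun g g' => by ext i; fin_cases i <;> rfl
      map_smul' := fun r g => by ext i; fin_cases i <;> rfl }
  have hinj : Function.Injective (R.domRestrict (LinearMap.ker S)) := by
    rw [← LinearMap.ker_eq_bot, LinearMap.ker_eq_bot']
    rintro ⟨g, hg⟩ hR
    have hR0 : g (c (x₀, 0)) = 0 := congrFun hR 0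
    have hR1 : g (c (x₀, 1)) = 0 := congrFun hR 1
    have hS : ∀ x, (g (c (x, 1)) - g (c (x, 3))) + (g (c (x, 0)) - g (c (x, 2))) = 0 :=
      fun x => congrFun hg x
    have horth := sum_sub_mul_sub_eq_zero hedge halt (fun d => g (c d))
      (fun d => congrArg g (hcφ d))
    have hsq : ∑ x, (g (c (x, 1)) - g (c (x, 3))) ^ 2 = 0 := by
      rw [← neg_eq_zero, ← Finset.sum_neg_distrib, ← horth]
      refine Finset.sum_congr rfl fun x _ => ?_
      have : g (c (x, 0)) - g (c (x, 2)) = - (g (c (x, 1)) - g (c (x, 3))) := by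
        linarith [hS x]
      rw [this]; ring
    have h13 : ∀ x, g (c (x, 1)) = g (c (x, 3)) := by
      intro x
      have := (Finset.sum_eq_zero_iff_of_nonneg (fun x _ => sq_nonneg _)).1 hsq x
        (Finset.mem_univ x)
      exact sub_eq_zero.1 (pow_eq_zero_iff two_ne_zero |>.1 this)
    have h02 : ∀ x, g (c (x, 0)) = g (c (x, 2)) := by
      intro x; linarith [hS x, h13 x]
    have hover : ∀ d : Dart X, IsOver d → g (c d) = g (c (d.1, 1)) := by
      rintro ⟨x, i⟩ (h | h) <;> dsimp only at h <;> subst h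
      · rfl
      · exact (h13 x).symm
    have hunder : ∀ d : Dart X, ¬ IsOver d → g (c d) = g (c (d.1, 0)) := by
      rintro ⟨x, i⟩ h
      have : i = 0 ∨ i = 2 := by
        unfold IsOver at h; dsimp only at h; revert i; decide
      rcases this with rfl | rfl
      · rfl
      · exact (h02 x).symm
    -- An edge borders one face of each color, so the vanishing of both values passes on to the next
    -- crossing.
    have huniv := hc {x | g (c (x, 0)) = 0 ∧ g (c (x, 1)) = 0} ⟨x₀, hR0, hR1⟩ (by
      rintro d ⟨h0, h1⟩
      have hz : ∀ i : ZMod 4, g (c (d.1, i)) = 0 := by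
        intro i
        by_cases ho : IsOver (d.1, i)
        · rw [hover _ ho, h1]
        · rw [hunder _ ho, h0]
      have e1 : g (c ((edge d).1, (edge d).2 - 1)) = 0 := by
        have : g (c ((edge d).1, (edge d).2 - 1)) = g (c d) := congrArg g (hcφ d)
        rw [this]; exact hz d.2
      have e2 : g (c (edge d)) = 0 := by
        have : g (c (d.1, d.2 - 1)) = g (c (edge d)) := by
          have := congrArg g (hcφ (edge d))
          rwa [facePerm_apply, hedge] at this
        rw [← this]; exact hz _
      by_cases ho : IsOver (edge d)
      · have hn : ¬ IsOver ((edge d).1, (edge d).2 - 1) := by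
          rw [isOver_sub_one, not_not]; exact ho
        rw [hover _ ho] at e2
        rw [hunder _ hn] at e1
        exact ⟨e1, e2⟩
      · have hn : IsOver ((edge d).1, (edge d).2 - 1) := by
          rw [isOver_sub_one]; exact ho
        rw [hunder _ ho] at e2
        rw [hover _ hn] at e1
        exact ⟨e2, e1⟩)
    refine Subtype.ext (funext fun q => ?_)
    induction q using Quotient.inductionOn with
    | h d =>
      have : d.1 ∈ {x | g (c (x, 0)) = 0 ∧ g (c (x, 1)) = 0} := by rw [huniv]; trivial
      change g (c d) = 0
      by_cases ho : IsOver d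
      · rw [hover _ ho, this.2]
      · rw [hunder _ ho, this.1]
  have h1 := LinearMap.finrank_le_finrank_of_injective hinj
  have h2 := LinearMap.finrank_range_add_finrank_ker S
  have h3 := Submodule.finrank_le (LinearMap.range S)
  rw [Module.finrank_fintype_fun_eq_card] at h1 h2 h3
  rw [Fintype.card_fin] at h1
  rw [faceCount, Nat.card_eq_fintype_card, Nat.card_eq_fintype_card]
  change Fintype.card Face ≤ _
  omega

namespace IsCut

variable {X : Type} [Finite X] {edge : Equiv.Perm (Dart X)} {M : Set X} {p s : Dart X}

/-- Every face of the whole diagram comes from a face of one side. The two faces of the complement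
that run along its new edge are different by parity, and their images already come from faces of
`M`, so they can be omitted. -/
theorem faceCount_add_two_le (h : IsCut edge M p s) (hedge : ∀ d, edge (edge d) = d)
    (halt : ∀ d, IsOver (edge d) ↔ ¬ IsOver d) :
    faceCount edge + 2 ≤
      faceCount (h.restrict hedge) + faceCount ((h.compl hedge halt).restrict hedge) := by
  have hc := h.compl hedge halt
  let f₁ : Quotient (Equiv.Perm.SameCycle.setoid (facePerm (h.restrict hedge))) →
      Quotient (Equiv.Perm.SameCycle.setoid (facePerm edge)) :=
    Quotient.map (dartIncl M) fun a b hab => h.sameCycle_of_restrict hedge halt hab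
  let f₂ : Quotient (Equiv.Perm.SameCycle.setoid (facePerm (hc.restrict hedge))) →
      Quotient (Equiv.Perm.SameCycle.setoid (facePerm edge)) :=
    Quotient.map (dartIncl Mᶜ) fun a b hab => hc.sameCycle_of_restrict hedge halt hab
  let a' : Dart (Mᶜ : Set X) := (⟨(edge s).1, hc.left_mem⟩, (edge s).2)
  let b' : Dart (Mᶜ : Set X) := (⟨(edge p).1, hc.right_mem⟩, (edge p).2)
  let a : Quotient (Equiv.Perm.SameCycle.setoid (facePerm (hc.restrict hedge))) :=
    Quotient.mk _ a'
  let b : Quotient (Equiv.Perm.SameCycle.setoid (facePerm (hc.restrict hedge))) :=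
    Quotient.mk _ b'
  have hab : a ≠ b := by
    intro heq
    have h1 : (facePerm (hc.restrict hedge)).SameCycle a' b' := Quotient.exact heq
    have h2 : IsOver (edge s) ↔ IsOver (edge p) :=
      isOver_of_sameCycle (hc.isOver_restrict hedge halt) h1
    have := hc.isOver_iff
    tauto
  let ψ : Quotient (Equiv.Perm.SameCycle.setoid (facePerm (h.restrict hedge))) ⊕
      ({a, b}ᶜ : Set (Quotient (Equiv.Perm.SameCycle.setoid (facePerm (hc.restrict hedge))))) →
      Quotient (Equiv.Perm.SameCycle.setoid (facePerm edge)) :=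
    Sum.elim f₁ (fun q => f₂ q.1)
  have hψ : Function.Surjective ψ := by
    intro q
    induction q using Quotient.inductionOn with
    | h d =>
    by_cases hd : d.1 ∈ M
    · exact ⟨Sum.inl (Quotient.mk _ (⟨d.1, hd⟩, d.2)), rfl⟩
    set q₂ : Quotient (Equiv.Perm.SameCycle.setoid (facePerm (hc.restrict hedge))) :=
      Quotient.mk _ (⟨d.1, hd⟩, d.2) with hq₂
    by_cases ha : q₂ = a
    · refine ⟨Sum.inl (Quotient.mk _ (⟨p.1, h.left_mem⟩, p.2)), ?_⟩
      have h1 : f₂ q₂ = f₂ a := congrArg f₂ ha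
      refine Eq.trans ?_ h1.symm
      exact Quotient.sound (h.sameCycle_left hedge halt)
    by_cases hb : q₂ = b
    · refine ⟨Sum.inl (Quotient.mk _ (⟨s.1, h.right_mem⟩, s.2)), ?_⟩
      have h1 : f₂ q₂ = f₂ b := congrArg f₂ hb
      refine Eq.trans ?_ h1.symm
      exact Quotient.sound (h.symm.sameCycle_left hedge halt)
    · exact ⟨Sum.inr ⟨q₂, by simp [ha, hb]⟩, rfl⟩
  have hcard := Nat.card_le_card_of_surjective ψ hψ
  rw [Nat.card_sum, Nat.card_coe_set_eq] at hcard
  have hcompl := Set.ncard_add_ncard_compl ({a, b} : Set _)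
  rw [Set.ncard_pair hab] at hcompl
  unfold faceCount
  omega

/-- The upper bounds for the two sides add up to exactly what the preceding inequality requires, so
both are equalities. -/
theorem faceCount_restrict [Nonempty X] (h : IsCut edge M p s) (hedge : ∀ d, edge (edge d) = d)
    (halt : ∀ d, IsOver (edge d) ↔ ¬ IsOver d) (hconn : IsConnectedMap edge)
    (hplanar : faceCount edge = Nat.card X + 2) :
    faceCount (h.restrict hedge) = Nat.card M + 2 := by
  have hc := h.compl hedge halt
  have : Nonempty M := ⟨⟨_, h.left_mem⟩⟩
  have : Nonempty (Mᶜ : Set X) := ⟨⟨_, hc.left_mem⟩⟩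
  have h1 := faceCount_le (h.restrict_restrict hedge) (h.isOver_restrict hedge halt)
    (h.isConnectedMap_restrict hedge hconn)
  have h2 := faceCount_le (hc.restrict_restrict hedge) (hc.isOver_restrict hedge halt)
    (hc.isConnectedMap_restrict hedge hconn)
  have h3 := h.faceCount_add_two_le hedge halt
  have h4 := Set.ncard_add_ncard_compl M
  rw [← Nat.card_coe_set_eq, ← Nat.card_coe_set_eq] at h4
  omega

end IsCut

/-- The diagram that remains on the side `M` of a cut of a connected alternating diagram. -/
noncomputable def cutSummand (D : LinkDiagram) {M : Set D.Crossing} {p s : Dart D.Crossing}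
    (h : IsCut D.edge M p s) (halt : D.Alternating) (hconn : IsConnectedMap D.edge) :
    LinkDiagram where
  Crossing := M
  edge := h.restrict D.edge_edge
  edge_edge := h.restrict_restrict D.edge_edge
  edge_ne := fun d hd => by
    have := h.isOver_restrict D.edge_edge halt d
    rw [hd] at this
    tauto
  loops := 0
  planar := by
    have : Nonempty D.Crossing := ⟨p.1⟩
    have : Nonempty M := ⟨⟨p.1, h.left_mem⟩⟩
    have h1 := (isConnectedMap_iff D.edge_edge).1 hconn
    have h2 := (isConnectedMap_iff (h.restrict_restrict D.edge_edge)).1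
      (h.isConnectedMap_restrict D.edge_edge hconn)
    rw [h2, h.faceCount_restrict D.edge_edge halt hconn]
    rw [D.planar, h1]

section Summand

variable (D : LinkDiagram) {M : Set D.Crossing} {p s : Dart D.Crossing}
  (h : IsCut D.edge M p s) (halt : D.Alternating) (hconn : IsConnectedMap D.edge)

theorem cutSummand_alternating : (D.cutSummand h halt hconn).Alternating :=
  h.isOver_restrict D.edge_edge halt

theorem cutSummand_isConnectedMap : IsConnectedMap (D.cutSummand h halt hconn).edge :=
  h.isConnectedMap_restrict D.edge_edge hconn

/-- Each face of the summand lies in one face of `D`, so a nugatory corner pair would persist in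
`D`. -/
theorem cutSummand_reduced (hred : D.Reduced) : (D.cutSummand h halt hconn).Reduced :=
  fun x i hxi => hred x.1 i (h.sameCycle_of_restrict D.edge_edge halt hxi)

open Classical in
theorem isSum_cutSummand (hloops : D.loops = 0) :
    IsSum (D.cutSummand h halt hconn)
      (D.cutSummand (h.compl D.edge_edge halt) halt hconn)
      (⟨p.1, h.left_mem⟩, p.2)
      (⟨(D.edge p).1, h.edge_left_notMem⟩, (D.edge p).2)
      D (Equiv.Set.sumCompl M) := by
  have hc := h.compl D.edge_edge halt
  have e1 : (D.cutSummand h halt hconn).edge (⟨p.1, h.left_mem⟩, p.2)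
      = (⟨s.1, h.right_mem⟩, s.2) :=
    dartIncl_injective _ (h.restrict_left D.edge_edge rfl)
  have e2 : (D.cutSummand (h.compl D.edge_edge halt) halt hconn).edge
      (⟨(D.edge p).1, h.edge_left_notMem⟩, (D.edge p).2)
      = (⟨(D.edge s).1, hc.left_mem⟩, (D.edge s).2) :=
    dartIncl_injective _ (hc.restrict_right D.edge_edge rfl)
  refine ⟨rfl, ?_, ?_, ?_, ?_⟩
  · rw [e1, e2]; rfl
  · intro m h1 h2
    refine (h.restrict_of_ne D.edge_edge (d := m) ?_ ?_).symm
    · intro hm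
      exact h1 (dartIncl_injective _ hm)
    · intro hm
      rw [e1] at h2
      exact h2 (dartIncl_injective _ hm)
  · intro m h1 h2
    refine (hc.restrict_of_ne D.edge_edge (d := m) ?_ ?_).symm
    · intro hm
      rw [e2] at h2
      exact h2 (dartIncl_injective _ hm)
    · intro hm
      exact h1 (dartIncl_injective _ hm)
  · exact hloops

end Summand

/-! ### Colorings of the darts and Reidemeister moves -/

/-- The colors `w 0, …, w 3` of the four darts at a crossing satisfy the Fox relation. -/
def IsCrossingColoring {A : Type} [AddCommGroup A] (w : ZMod 4 → A) : Prop :=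
  w 1 = w 3 ∧ w 0 + w 2 = w 1 + w 1

/-- A Fox coloring with values in an abelian group, as a function on the darts. -/
structure IsDartColoring {X A : Type} [AddCommGroup A] (edge : Equiv.Perm (Dart X))
    (g : Dart X → A) : Prop where
  edge_eq : ∀ d, g (edge d) = g d
  crossing : ∀ x, IsCrossingColoring fun i => g (x, i)

/-- The Fox relation is invariant under a half turn, so it can be read from either end of the
over-strand. -/
theorem isCrossingColoring_iff_of_odd {A : Type} [AddCommGroup A] {w : ZMod 4 → A} {i : ZMod 4}
    (hi : i = 1 ∨ i = 3) :
    IsCrossingColoring w ↔ w i = w (i + 2) ∧ w (i + 1) + w (i + 3) = w i + w i := by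
  have e : (1 : ZMod 4) + 2 = 3 ∧ (1 : ZMod 4) + 1 = 2 ∧ (1 : ZMod 4) + 3 = 0 ∧
    (3 : ZMod 4) + 2 = 1 ∧ (3 : ZMod 4) + 1 = 0 ∧ (3 : ZMod 4) + 3 = 2 := by decide
  unfold IsCrossingColoring
  rcases hi with rfl | rfl
  · rw [e.1, e.2.1, e.2.2.1, add_comm (w 2)]
  · rw [e.2.2.2.1, e.2.2.2.2.1, e.2.2.2.2.2, eq_comm (a := w 3)]
    constructor <;> rintro ⟨h1, h2⟩ <;> exact ⟨h1, by rw [h2, h1]⟩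

theorem isCrossingColoring_iff_of_even {A : Type} [AddCommGroup A] {w : ZMod 4 → A} {i : ZMod 4}
    (hi : i = 0 ∨ i = 2) :
    IsCrossingColoring w ↔
      w (i + 1) = w (i + 3) ∧ w i + w (i + 2) = w (i + 1) + w (i + 1) := by
  have e : (0 : ZMod 4) + 2 = 2 ∧ (0 : ZMod 4) + 1 = 1 ∧ (0 : ZMod 4) + 3 = 3 ∧
    (2 : ZMod 4) + 2 = 0 ∧ (2 : ZMod 4) + 1 = 3 ∧ (2 : ZMod 4) + 3 = 1 := by decide
  unfold IsCrossingColoring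
  rcases hi with rfl | rfl
  · rw [e.1, e.2.1, e.2.2.1]
  · rw [e.2.2.2.1, e.2.2.2.2.1, e.2.2.2.2.2, eq_comm (a := w 3), add_comm (w 2)]
    constructor <;> rintro ⟨h1, h2⟩ <;> exact ⟨h1, by rw [h2, h1]⟩

theorem zmod_four_cases (i : ZMod 4) : (i = 1 ∨ i = 3) ∨ (i = 0 ∨ i = 2) := by
  revert i; decide

theorem zmod_four_exhaust (i j : ZMod 4) : j = i ∨ j = i + 1 ∨ j = i + 2 ∨ j = i + 3 := by
  revert i j; decide

theorem isCrossingColoring_const {A : Type} [AddCommGroup A] (a : A) :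
    IsCrossingColoring fun _ : ZMod 4 => a := ⟨rfl, rfl⟩

theorem isDartColoring_const {X A : Type} [AddCommGroup A] (edge : Equiv.Perm (Dart X)) (a : A) :
    IsDartColoring edge fun _ => a :=
  ⟨fun _ => rfl, fun _ => isCrossingColoring_const a⟩

/-- At a kink all four darts have the same color. -/
theorem IsCrossingColoring.eq_of_kink {A : Type} [AddCommGroup A] {w : ZMod 4 → A}
    (hw : IsCrossingColoring w) {i : ZMod 4} (h : w i = w (i + 1)) (j : ZMod 4) : w j = w i := by
  rcases zmod_four_cases i with hi | hi
  · obtain ⟨h1, h2⟩ := (isCrossingColoring_iff_of_odd hi).1 hw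
    rw [← h, add_left_cancel_iff] at h2
    rcases zmod_four_exhaust i j with rfl | rfl | rfl | rfl
    · rfl
    · exact h.symm
    · exact h1.symm
    · exact h2
  · obtain ⟨h1, h2⟩ := (isCrossingColoring_iff_of_even hi).1 hw
    rw [← h, add_left_cancel_iff] at h2
    rcases zmod_four_exhaust i j with rfl | rfl | rfl | rfl
    · rfl
    · exact h.symm
    · exact h2
    · rw [← h1, h]

/-- The number of Fox colorings of a diagram with values in `A`. -/
noncomputable def colCount (D : LinkDiagram) (A : Type) [AddCommGroup A] : ℕ :=
  Nat.card {g : Dart D.Crossing → A // IsDartColoring D.edge g} * Nat.card A ^ D.loops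

/-! ### Relabellings and the first Reidemeister move. -/

section Moves

variable {D₁ D₂ : LinkDiagram} (A : Type) [AddCommGroup A]

theorem IsIso.colCount_eq (h : IsIso D₁ D₂) : D₁.colCount A = D₂.colCount A := by
  obtain ⟨f, r, hr, he, hl⟩ := h
  unfold colCount
  rw [hl]
  congr 1
  have hcr : ∀ (x : D₁.Crossing) (w : ZMod 4 → A),
      IsCrossingColoring (fun i => w (i + r x)) ↔ IsCrossingColoring w := by
    intro x w
    rcases hr x with h | h <;> rw [h]
    · simp only [add_zero]
    · rw [isCrossingColoring_iff_of_even (w := w) (i := 2) (Or.inr rfl)]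
      simp only [IsCrossingColoring]
      have e : (1 : ZMod 4) + 2 = 2 + 1 ∧ (3 : ZMod 4) + 2 = 2 + 3 ∧ (0 : ZMod 4) + 2 = 2 := by decide
      rw [e.1, e.2.1, e.2.2]
  let φ : Dart D₁.Crossing ≃ Dart D₂.Crossing :=
    { toFun := fun d => (f d.1, d.2 + r d.1)
      invFun := fun d => (f.symm d.1, d.2 - r (f.symm d.1))
      left_inv := fun d => by simp
      right_inv := fun d => by simp }
  have hφ : ∀ d, D₂.edge (φ d) = φ (D₁.edge d) := fun d => he d.1 d.2 _ _ rfl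
  refine Nat.card_congr (Equiv.subtypeEquiv (φ.arrowCongr (Equiv.refl A)) fun g => ?_)
  have hval : ∀ d, (φ.arrowCongr (Equiv.refl A)) g (φ d) = g d := fun d => by simp
  set g' := (φ.arrowCongr (Equiv.refl A)) g
  have hx : ∀ x, IsCrossingColoring (fun i => g (x, i)) ↔
      IsCrossingColoring (fun i => g' (f x, i)) := by
    intro x
    rw [← hcr x (fun i => g' (f x, i))]
    exact iff_of_eq (congrArg _ (funext fun i => (hval (x, i)).symm))
  constructor
  · rintro ⟨h1, h2⟩
    refine ⟨fun d => ?_, fun x => ?_⟩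
    · obtain ⟨d, rfl⟩ := φ.surjective d
      rw [hφ, hval, hval, h1]
    · obtain ⟨x, rfl⟩ := f.surjective x
      exact (hx x).1 (h2 x)
  · rintro ⟨h1, h2⟩
    exact ⟨fun d => by rw [← hval, ← hφ, h1, hval], fun x => (hx x).2 (h2 _)⟩

/-- A dart lies at one of the old crossings or at one of the new crossings. -/
theorem dart_sum_cases {X Y Z : Type} (f : X ⊕ Y ≃ Z) (d : Dart Z) :
    (∃ m : Dart X, d = (f (Sum.inl m.1), m.2)) ∨ ∃ (y : Y) (i : ZMod 4), d = (f (Sum.inr y), i) := by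
  obtain ⟨z, i⟩ := d
  obtain ⟨w, rfl⟩ := f.surjective z
  rcases w with x | y
  · exact Or.inl ⟨(x, i), rfl⟩
  · exact Or.inr ⟨y, i, rfl⟩

/-- The kink carries the color of the edge into which it is inserted, so restriction to the old
darts is a bijection on colorings. -/
theorem IsR1.colCount_eq (h : IsR1 D₁ D₂) : D₁.colCount A = D₂.colCount A := by
  obtain ⟨f, h, i, hc, hh, hh', hold, hl⟩ := h
  dsimp only at hh hh' hold
  unfold colCount
  rw [hl]
  congr 1
  have hnew : ∀ g : Dart D₂.Crossing → A, IsDartColoring D₂.edge g → ∀ j,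
      g (f (Sum.inr ()), j) = g (f (Sum.inl h.1), h.2) := by
    intro g hg j
    have hkink := (hg.crossing (f (Sum.inr ()))).eq_of_kink (i := i)
      (by rw [← hc, hg.edge_eq])
    rw [hkink j, ← hkink (i + 2), ← hh, hg.edge_eq]
  symm
  refine Nat.card_congr (Equiv.ofBijective
    (fun g => ⟨fun m => g.1 (f (Sum.inl m.1), m.2), ?_, fun x => g.2.crossing _⟩) ⟨?_, ?_⟩)
  · obtain ⟨g, hg⟩ := g
    have key : g (f (Sum.inl (D₁.edge h).1), (D₁.edge h).2) = g (f (Sum.inl h.1), h.2) := by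
      rw [← hg.edge_eq, hh', hnew g hg]
    intro m
    dsimp only
    by_cases h1 : m = h
    · rw [h1, key]
    by_cases h2 : m = D₁.edge h
    · rw [h2, D₁.edge_edge, key]
    · rw [← hold m h1 h2, hg.edge_eq]
  · rintro ⟨g, hg⟩ ⟨g', hg'⟩ heq
    have heq' : ∀ m : Dart D₁.Crossing,
        g (f (Sum.inl m.1), m.2) = g' (f (Sum.inl m.1), m.2) :=
      fun m => congrFun (Subtype.mk.inj heq) m
    refine Subtype.ext (funext fun d => ?_)
    rcases dart_sum_cases f d with ⟨m, rfl⟩ | ⟨⟨⟩, j, rfl⟩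
    · exact heq' m
    · change g _ = g' _
      rw [hnew g hg, hnew g' hg', heq']
  · rintro ⟨g, hg⟩
    let G : Dart D₂.Crossing → A := fun d =>
      Sum.elim (fun x => g (x, d.2)) (fun _ => g h) (f.symm d.1)
    have hGl : ∀ m : Dart D₁.Crossing, G (f (Sum.inl m.1), m.2) = g m := fun m => by simp [G]
    have hGr : ∀ j, G (f (Sum.inr ()), j) = g h := fun j => by simp [G]
    refine ⟨⟨G, fun d => ?_, fun x => ?_⟩, Subtype.ext (funext hGl)⟩
    · rcases dart_sum_cases f d with ⟨m, rfl⟩ | ⟨⟨⟩, j, rfl⟩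
      · by_cases h1 : m = h
        · rw [h1, hh, hGl, hGr]
        by_cases h2 : m = D₁.edge h
        · rw [h2, hh', hGl, hGr, hg.edge_eq]
        · rw [hold m h1 h2, hGl, hGl, hg.edge_eq]
      · rw [hGr]
        rcases zmod_four_exhaust i j with rfl | rfl | rfl | rfl
        · rw [hc, hGr]
        · rw [← hc, D₂.edge_edge, hGr]
        · rw [← hh, D₂.edge_edge, hGl]
        · rw [← hh', D₂.edge_edge, hGl, hg.edge_eq]
    · obtain ⟨w, rfl⟩ := f.surjective x
      rcases w with x | ⟨⟩
      · have := hg.crossing x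
        simpa only [← hGl (x, _)] using this
      · simpa only [hGr] using isCrossingColoring_const (g h)

/-- The single color at the new crossing replaces the free color of the lost crossingless curve, a
factor `Nat.card A` on either side. -/
theorem IsR1Loop.colCount_eq (h : IsR1Loop D₁ D₂) : D₁.colCount A = D₂.colCount A := by
  obtain ⟨f, i, hc, hc', hold, hl⟩ := h
  dsimp only at hold
  unfold colCount
  rw [hl, pow_succ', ← mul_assoc, ← Nat.card_prod]
  congr 1
  symm
  refine Nat.card_congr (Equiv.ofBijective
    (fun g => (⟨fun m => g.1 (f (Sum.inl m.1), m.2), fun m => ?_, fun x => g.2.crossing _⟩,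
      g.1 (f (Sum.inr ()), i))) ⟨?_, ?_⟩)
  · rw [← hold, g.2.edge_eq]
  · rintro ⟨g, hg⟩ ⟨g', hg'⟩ heq
    have heq' : ∀ m : Dart D₁.Crossing,
        g (f (Sum.inl m.1), m.2) = g' (f (Sum.inl m.1), m.2) :=
      fun m => congrFun (Subtype.mk.inj (congrArg Prod.fst heq)) m
    have heq'' : g (f (Sum.inr ()), i) = g' (f (Sum.inr ()), i) := congrArg Prod.snd heq
    refine Subtype.ext (funext fun d => ?_)
    rcases dart_sum_cases f d with ⟨m, rfl⟩ | ⟨⟨⟩, j, rfl⟩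
    · exact heq' m
    · have k1 := (hg.crossing (f (Sum.inr ()))).eq_of_kink (i := i)
        (by rw [← hc, hg.edge_eq]) j
      have k2 := (hg'.crossing (f (Sum.inr ()))).eq_of_kink (i := i)
        (by rw [← hc, hg'.edge_eq]) j
      exact k1.trans (heq''.trans k2.symm)
  · rintro ⟨⟨g, hg⟩, a⟩
    let G : Dart D₂.Crossing → A := fun d =>
      Sum.elim (fun x => g (x, d.2)) (fun _ => a) (f.symm d.1)
    have hGl : ∀ m : Dart D₁.Crossing, G (f (Sum.inl m.1), m.2) = g m := fun m => by simp [G]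
    have hGr : ∀ j, G (f (Sum.inr ()), j) = a := fun j => by simp [G]
    refine ⟨⟨G, fun d => ?_, fun x => ?_⟩, Prod.ext (Subtype.ext (funext hGl)) (hGr i)⟩
    · rcases dart_sum_cases f d with ⟨m, rfl⟩ | ⟨⟨⟩, j, rfl⟩
      · rw [hold m, hGl, hGl, hg.edge_eq]
      · rw [hGr]
        rcases zmod_four_exhaust i j with rfl | rfl | rfl | rfl
        · rw [hc, hGr]
        · rw [← hc, D₂.edge_edge, hGr]
        · rw [hc', hGr]
        · rw [← hc', D₂.edge_edge, hGr]
    · obtain ⟨w, rfl⟩ := f.surjective x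
      rcases w with x | ⟨⟩
      · have := hg.crossing x
        simpa only [← hGl (x, _)] using this
      · simpa only [hGr] using isCrossingColoring_const a

end Moves

/-- The four colors `w₀, …, w₃`, in counterclockwise order from the position `i` on. -/
def cyclicColors {A : Type} (i : ZMod 4) (w₀ w₁ w₂ w₃ : A) (j : ZMod 4) : A :=
  (![w₀, w₁, w₂, w₃] : Fin 4 → A) (j - i : ZMod 4)

section CyclicColors

variable {A : Type} (i : ZMod 4) (w₀ w₁ w₂ w₃ : A)

theorem cyclicColors_zero : cyclicColors i w₀ w₁ w₂ w₃ i = w₀ := by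
  rw [cyclicColors, sub_self]; rfl

theorem cyclicColors_one : cyclicColors i w₀ w₁ w₂ w₃ (i + 1) = w₁ := by
  rw [cyclicColors, add_sub_cancel_left]; rfl

theorem cyclicColors_two : cyclicColors i w₀ w₁ w₂ w₃ (i + 2) = w₂ := by
  rw [cyclicColors, add_sub_cancel_left]; rfl

theorem cyclicColors_three : cyclicColors i w₀ w₁ w₂ w₃ (i + 3) = w₃ := by
  rw [cyclicColors, add_sub_cancel_left]; rfl

end CyclicColors

/-- The color of the strand of the positions `i`, `i + 2` beyond a crossing, where it has the color
`a` at `i` and the other strand has the color `b` on one side. -/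
def beyond {A : Type} [AddCommGroup A] (i : ZMod 4) (a b : A) : A :=
  if i = 1 ∨ i = 3 then a else b + b - a

/-- The color of the strand of the positions `i + 1`, `i + 3` beyond a crossing, where it has the
color `b` on one side and the other strand has the color `a` at `i`. -/
def across {A : Type} [AddCommGroup A] (i : ZMod 4) (a b : A) : A :=
  if i = 1 ∨ i = 3 then a + a - b else b

theorem odd_or_even (i : ZMod 4) : (i = 1 ∨ i = 3) ∨ ¬ (i = 1 ∨ i = 3) ∧ (i = 0 ∨ i = 2) := by
  revert i; decide

theorem isCrossingColoring_iff_add_one {A : Type} [AddCommGroup A] {w : ZMod 4 → A} (i : ZMod 4) :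
    IsCrossingColoring w ↔
      w (i + 2) = beyond i (w i) (w (i + 1)) ∧ w (i + 3) = across i (w i) (w (i + 1)) := by
  unfold beyond across
  rcases odd_or_even i with hi | ⟨hn, hi⟩
  · rw [isCrossingColoring_iff_of_odd hi, if_pos hi, if_pos hi, eq_sub_iff_add_eq',
      eq_comm (a := w i)]
  · rw [isCrossingColoring_iff_of_even hi, if_neg hn, if_neg hn, eq_sub_iff_add_eq',
      eq_comm (a := w (i + 1)), and_comm]

theorem isCrossingColoring_iff_add_three {A : Type} [AddCommGroup A] {w : ZMod 4 → A}
    (i : ZMod 4) :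
    IsCrossingColoring w ↔
      w (i + 2) = beyond i (w i) (w (i + 3)) ∧ w (i + 1) = across i (w i) (w (i + 3)) := by
  unfold beyond across
  rcases odd_or_even i with hi | ⟨hn, hi⟩
  · rw [isCrossingColoring_iff_of_odd hi, if_pos hi, if_pos hi, eq_sub_iff_add_eq,
      eq_comm (a := w i)]
  · rw [isCrossingColoring_iff_of_even hi, if_neg hn, if_neg hn, eq_sub_iff_add_eq']
    constructor
    · rintro ⟨h1, h2⟩; exact ⟨by rw [h2, h1], h1⟩
    · rintro ⟨h1, h2⟩; exact ⟨h2, by rw [h1, h2]⟩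

/-- The colors on two neighboring darts can be recovered from the other two. In the second move this
identifies the colors before and after the overlap. -/
theorem eq_of_beyond_of_across {A : Type} [AddCommGroup A] {i : ZMod 4} {a b a' b' : A}
    (h₁ : beyond i a b = beyond i a' b') (h₂ : across i a b = across i a' b') :
    a = a' ∧ b = b' := by
  unfold beyond at h₁
  unfold across at h₂
  split_ifs at h₁ h₂
  · subst h₁; exact ⟨rfl, sub_right_inj.1 h₂⟩
  · subst h₂; exact ⟨sub_right_inj.1 h₁, rfl⟩

/-! ### The second Reidemeister move and the combinatorics of the third. -/

section Moves

variable {D₁ D₂ : LinkDiagram} (A : Type) [AddCommGroup A]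

theorem IsR2.colCount_eq (h : IsR2 D₁ D₂) : D₁.colCount A = D₂.colCount A := by
  obtain ⟨f, h, k, i, -, -, -, hh, hcd, hh', hk, hdc, hk', hold, hl⟩ := h
  dsimp only at hh hcd hh' hk hdc hk' hold
  unfold colCount
  rw [hl]
  congr 1
  symm
  have hnew : ∀ g : Dart D₂.Crossing → A, IsDartColoring D₂.edge g →
      g (f (Sum.inl (D₁.edge h).1), (D₁.edge h).2) = g (f (Sum.inl h.1), h.2) ∧
      g (f (Sum.inl (D₁.edge k).1), (D₁.edge k).2) = g (f (Sum.inl k.1), k.2) ∧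
      (∀ j, g (f (Sum.inr false), j) = cyclicColors i (g (f (Sum.inl h.1), h.2))
        (across i (g (f (Sum.inl h.1), h.2)) (g (f (Sum.inl k.1), k.2)))
        (beyond i (g (f (Sum.inl h.1), h.2)) (g (f (Sum.inl k.1), k.2)))
        (g (f (Sum.inl k.1), k.2)) j) ∧
      (∀ j, g (f (Sum.inr true), j) = cyclicColors i (g (f (Sum.inl h.1), h.2))
        (g (f (Sum.inl k.1), k.2))
        (beyond i (g (f (Sum.inl h.1), h.2)) (g (f (Sum.inl k.1), k.2)))
        (across i (g (f (Sum.inl h.1), h.2)) (g (f (Sum.inl k.1), k.2))) j) := by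
    intro g hg
    have e1 := hg.edge_eq (f (Sum.inl h.1), h.2)
    have e2 := hg.edge_eq (f (Sum.inr false), i + 2)
    have e3 := hg.edge_eq (f (Sum.inr true), i)
    have e4 := hg.edge_eq (f (Sum.inl k.1), k.2)
    have e5 := hg.edge_eq (f (Sum.inr true), i + 3)
    have e6 := hg.edge_eq (f (Sum.inr false), i + 3)
    rw [hh] at e1
    rw [hcd] at e2
    rw [hh'] at e3
    rw [hk] at e4
    rw [hdc] at e5
    rw [hk'] at e6
    obtain ⟨c1, c2⟩ := (isCrossingColoring_iff_add_three i).1 (hg.crossing (f (Sum.inr false)))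
    obtain ⟨d1, d2⟩ := (isCrossingColoring_iff_add_one i).1 (hg.crossing (f (Sum.inr true)))
    have h3 := e3
    rw [e1, ← e6] at c1 c2
    rw [← e3, e4] at d1 d2
    -- Both crossings send their outer colors to the same pair of colors on the bigon, so the outer
    -- colors agree.
    obtain ⟨k1, k2⟩ := eq_of_beyond_of_across (c1.symm.trans (e2.symm.trans d1))
      (c2.symm.trans (e5.trans d2))
    rw [← k1] at d1 d2 h3
    rw [k2] at c1 c2 e6
    refine ⟨k1.symm, k2, fun j => ?_, fun j => ?_⟩
    · rcases zmod_four_exhaust i j with rfl | rfl | rfl | rfl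
      · rw [cyclicColors_zero, e1]
      · rw [cyclicColors_one, c2]
      · rw [cyclicColors_two, c1]
      · rw [cyclicColors_three, e6]
    · rcases zmod_four_exhaust i j with rfl | rfl | rfl | rfl
      · rw [cyclicColors_zero, h3]
      · rw [cyclicColors_one, e4]
      · rw [cyclicColors_two, d1]
      · rw [cyclicColors_three, d2]
  refine Nat.card_congr (Equiv.ofBijective
    (fun g => ⟨fun m => g.1 (f (Sum.inl m.1), m.2), ?_, fun x => g.2.crossing _⟩) ⟨?_, ?_⟩)
  · obtain ⟨g, hg⟩ := g
    obtain ⟨k1, k2, -, -⟩ := hnew g hg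
    intro m
    dsimp only
    by_cases h1 : m = h
    · rw [h1, k1]
    by_cases h2 : m = D₁.edge h
    · rw [h2, D₁.edge_edge, k1]
    by_cases h3 : m = k
    · rw [h3, k2]
    by_cases h4 : m = D₁.edge k
    · rw [h4, D₁.edge_edge, k2]
    · rw [← hold m h1 h2 h3 h4, hg.edge_eq]
  · rintro ⟨g, hg⟩ ⟨g', hg'⟩ heq
    have heq' : ∀ m : Dart D₁.Crossing,
        g (f (Sum.inl m.1), m.2) = g' (f (Sum.inl m.1), m.2) :=
      fun m => congrFun (Subtype.mk.inj heq) m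
    obtain ⟨-, -, k3, k4⟩ := hnew g hg
    obtain ⟨-, -, k3', k4'⟩ := hnew g' hg'
    refine Subtype.ext (funext fun d => ?_)
    rcases dart_sum_cases f d with ⟨m, rfl⟩ | ⟨_ | _, j, rfl⟩
    · exact heq' m
    · change g _ = g' _
      rw [k3, k3', heq', heq']
    · change g _ = g' _
      rw [k4, k4', heq', heq']
  · rintro ⟨g, hg⟩
    let G : Dart D₂.Crossing → A := fun d =>
      Sum.elim (fun x => g (x, d.2)) (fun b => if b then
          cyclicColors i (g h) (g k) (beyond i (g h) (g k)) (across i (g h) (g k)) d.2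
        else cyclicColors i (g h) (across i (g h) (g k)) (beyond i (g h) (g k)) (g k) d.2)
        (f.symm d.1)
    have hGl : ∀ m : Dart D₁.Crossing, G (f (Sum.inl m.1), m.2) = g m := fun m => by simp [G]
    have hGc : ∀ j, G (f (Sum.inr false), j) =
        cyclicColors i (g h) (across i (g h) (g k)) (beyond i (g h) (g k)) (g k) j :=
      fun j => by simp [G]
    have hGd : ∀ j, G (f (Sum.inr true), j) =
        cyclicColors i (g h) (g k) (beyond i (g h) (g k)) (across i (g h) (g k)) j :=
      fun j => by simp [G]
    refine ⟨⟨G, fun d => ?_, fun x => ?_⟩, Subtype.ext (funext hGl)⟩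
    · rcases dart_sum_cases f d with ⟨m, rfl⟩ | ⟨_ | _, j, rfl⟩
      · by_cases h1 : m = h
        · rw [h1, hh, hGl, hGc, cyclicColors_zero]
        by_cases h2 : m = D₁.edge h
        · rw [h2, ← hh', D₂.edge_edge, hh', hGl, hGd, cyclicColors_zero, hg.edge_eq]
        by_cases h3 : m = k
        · rw [h3, hk, hGl, hGd, cyclicColors_one]
        by_cases h4 : m = D₁.edge k
        · rw [h4, ← hk', D₂.edge_edge, hk', hGl, hGc, cyclicColors_three, hg.edge_eq]
        · rw [hold m h1 h2 h3 h4, hGl, hGl, hg.edge_eq]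
      · rw [hGc]
        rcases zmod_four_exhaust i j with rfl | rfl | rfl | rfl
        · rw [← hh, D₂.edge_edge, hGl, cyclicColors_zero]
        · rw [← hdc, D₂.edge_edge, hGd, cyclicColors_one, cyclicColors_three]
        · rw [hcd, hGd, cyclicColors_two, cyclicColors_two]
        · rw [hk', hGl, hg.edge_eq, cyclicColors_three]
      · rw [hGd]
        rcases zmod_four_exhaust i j with rfl | rfl | rfl | rfl
        · rw [hh', hGl, hg.edge_eq, cyclicColors_zero]
        · rw [← hk, D₂.edge_edge, hGl, cyclicColors_one]
        · rw [← hcd, D₂.edge_edge, hGc, cyclicColors_two, cyclicColors_two]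
        · rw [hdc, hGc, cyclicColors_one, cyclicColors_three]
    · obtain ⟨w, rfl⟩ := f.surjective x
      rcases w with x | _ | _
      · have := hg.crossing x
        simpa only [← hGl (x, _)] using this
      · simp only [hGc]
        rw [isCrossingColoring_iff_add_three i, cyclicColors_zero, cyclicColors_one,
          cyclicColors_two, cyclicColors_three]
        exact ⟨rfl, rfl⟩
      · simp only [hGd]
        rw [isCrossingColoring_iff_add_one i, cyclicColors_zero, cyclicColors_one,
          cyclicColors_two, cyclicColors_three]
        exact ⟨rfl, rfl⟩

/-- The third Reidemeister move with the exchange of darts given by its values. -/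
structure IsTriangleMove (D₁ D₂ : LinkDiagram) (f : D₁.Crossing ≃ D₂.Crossing)
    (x y z : D₁.Crossing) (i j k : ZMod 4) (e : Dart D₁.Crossing → Dart D₁.Crossing) : Prop where
  ne_xy : x ≠ y
  ne_yz : y ≠ z
  ne_zx : z ≠ x
  edge_x : D₁.edge (x, i) = (y, j + 1)
  edge_y : D₁.edge (y, j) = (z, k + 1)
  edge_z : D₁.edge (z, k) = (x, i + 1)
  odd : i = 1 ∨ i = 3
  even : j = 0 ∨ j = 2
  invol : ∀ m, e (e m) = m
  exch_x : e (x, i) = (y, j + 3)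
  exch_x' : e (x, i + 2) = (y, j + 1)
  exch_y : e (y, j) = (z, k + 3)
  exch_y' : e (y, j + 2) = (z, k + 1)
  exch_z : e (z, k) = (x, i + 3)
  exch_z' : e (z, k + 2) = (x, i + 1)
  exch_ne : ∀ m : Dart D₁.Crossing, m.1 ≠ x → m.1 ≠ y → m.1 ≠ z → e m = m
  edge_exch : ∀ m, D₂.edge (f (e m).1, (e m).2) = (f (e (D₁.edge m)).1, (e (D₁.edge m)).2)
  loops : D₂.loops = D₁.loops

/-- Evaluating the product of transpositions at all twelve darts of the triangle replaces it by a
table, from which the symmetry of the move can be read. -/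
theorem IsR3.exists_isTriangleMove (h : IsR3 D₁ D₂) :
    ∃ f x y z i j k e, IsTriangleMove D₁ D₂ f x y z i j k e := by
  classical
  obtain ⟨f, x, y, z, i, j, k, hxy, hyz, hzx, h1, h2, h3, hi, hj, he, hl⟩ := h
  dsimp only at he
  have a0 : ∀ a : ZMod 4, a + 1 + 2 = a + 3 := by decide
  have a1 : ∀ a : ZMod 4, a ≠ a + 1 ∧ a ≠ a + 2 ∧ a ≠ a + 3 ∧ a + 1 ≠ a + 2 ∧ a + 1 ≠ a + 3 ∧
    a + 2 ≠ a + 3 ∧ a + 1 ≠ a ∧ a + 2 ≠ a ∧ a + 3 ≠ a ∧ a + 2 ≠ a + 1 ∧ a + 3 ≠ a + 1 ∧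
    a + 3 ≠ a + 2 := by decide
  simp only [a0] at he
  generalize hE : (Equiv.swap (x, i) (y, j + 3) * Equiv.swap (y, j + 1) (x, i + 2) *
    (Equiv.swap (y, j) (z, k + 3) * Equiv.swap (z, k + 1) (y, j + 2)) *
    (Equiv.swap (z, k) (x, i + 3) * Equiv.swap (x, i + 1) (z, k + 2)) :
    Equiv.Perm (Dart D₁.Crossing)) = E at he
  have hE' : ∀ m, E m = Equiv.swap (x, i) (y, j + 3) (Equiv.swap (y, j + 1) (x, i + 2)
    (Equiv.swap (y, j) (z, k + 3) (Equiv.swap (z, k + 1) (y, j + 2)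
    (Equiv.swap (z, k) (x, i + 3) (Equiv.swap (x, i + 1) (z, k + 2) m))))) := by
    intro m; rw [← hE]; rfl
  have table : E (x, i) = (y, j + 3) ∧ E (x, i + 1) = (z, k + 2) ∧ E (x, i + 2) = (y, j + 1) ∧
      E (x, i + 3) = (z, k) ∧ E (y, j) = (z, k + 3) ∧ E (y, j + 1) = (x, i + 2) ∧
      E (y, j + 2) = (z, k + 1) ∧ E (y, j + 3) = (x, i) ∧ E (z, k) = (x, i + 3) ∧
      E (z, k + 1) = (y, j + 2) ∧ E (z, k + 2) = (x, i + 1) ∧ E (z, k + 3) = (y, j) := by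
    simp only [hE']
    refine ⟨?_, ?_, ?_, ?_, ?_, ?_, ?_, ?_, ?_, ?_, ?_, ?_⟩ <;>
    simp only [Equiv.swap_apply_def, Prod.mk.injEq, hxy, hyz, hzx, hxy.symm, hyz.symm, hzx.symm,
      a1, and_false, false_and, if_true, if_false]
  have hne : ∀ m : Dart D₁.Crossing, m.1 ≠ x → m.1 ≠ y → m.1 ≠ z → E m = m := by
    rintro ⟨w, l⟩ h1 h2 h3
    dsimp only at h1 h2 h3
    simp only [hE', Equiv.swap_apply_def, Prod.mk.injEq, h1, h2, h3, false_and, if_false]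
  obtain ⟨t1, t2, t3, t4, t5, t6, t7, t8, t9, t10, t11, t12⟩ := table
  refine ⟨f, x, y, z, i, j, k, E, hxy, hyz, hzx, h1, h2, h3, hi, hj, ?_, t1, t3, t5, t7, t9, t11,
    hne, he, hl⟩
  rintro ⟨w, l⟩
  by_cases hwx : w = x
  · subst hwx
    rcases zmod_four_exhaust i l with rfl | rfl | rfl | rfl
    · rw [t1, t8]
    · rw [t2, t11]
    · rw [t3, t6]
    · rw [t4, t9]
  by_cases hwy : w = y
  · subst hwy
    rcases zmod_four_exhaust j l with rfl | rfl | rfl | rfl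
    · rw [t5, t12]
    · rw [t6, t3]
    · rw [t7, t10]
    · rw [t8, t1]
  by_cases hwz : w = z
  · subst hwz
    rcases zmod_four_exhaust k l with rfl | rfl | rfl | rfl
    · rw [t9, t4]
    · rw [t10, t7]
    · rw [t11, t2]
    · rw [t12, t5]
  · rw [hne (w, l) hwx hwy hwz, hne (w, l) hwx hwy hwz]

end Moves

/-! ### Transport of colorings through the third Reidemeister move. -/

namespace IsTriangleMove

variable {D₁ D₂ : LinkDiagram} {f : D₁.Crossing ≃ D₂.Crossing}
  {x y z : D₁.Crossing} {i j k : ZMod 4} {e : Dart D₁.Crossing → Dart D₁.Crossing}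

/-- After the move the triangle lies between the opposite darts, so every position shifts by two. -/
theorem symm (h : IsTriangleMove D₁ D₂ f x y z i j k e) :
    IsTriangleMove D₂ D₁ f.symm (f x) (f y) (f z) (i + 2) (j + 2) (k + 2)
      (fun m => (f (e (f.symm m.1, m.2)).1, (e (f.symm m.1, m.2)).2)) := by
  have a0 : ∀ a : ZMod 4, a + 2 + 3 = a + 1 ∧ a + 2 + 1 = a + 3 ∧ a + 2 + 2 = a := by decide
  have he : ∀ m, D₂.edge (f m.1, m.2) = (f (e (D₁.edge (e m))).1, (e (D₁.edge (e m))).2) := by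
    intro m
    have := h.edge_exch (e m)
    rwa [h.invol] at this
  have hx3 : e (y, j + 1) = (x, i + 2) := by rw [← h.exch_x', h.invol]
  have hy3 : e (z, k + 1) = (y, j + 2) := by rw [← h.exch_y', h.invol]
  have hz3 : e (x, i + 1) = (z, k + 2) := by rw [← h.exch_z', h.invol]
  refine ⟨fun hh => h.ne_xy (f.injective hh), fun hh => h.ne_yz (f.injective hh),
    fun hh => h.ne_zx (f.injective hh), ?_, ?_, ?_, ?_, ?_, ?_, ?_, ?_, ?_, ?_, ?_, ?_, ?_, ?_,
    h.loops.symm⟩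
  · rw [he (x, i + 2), h.exch_x', ← h.edge_x, D₁.edge_edge, h.exch_x, (a0 j).2.1]
  · rw [he (y, j + 2), h.exch_y', ← h.edge_y, D₁.edge_edge, h.exch_y, (a0 k).2.1]
  · rw [he (z, k + 2), h.exch_z', ← h.edge_z, D₁.edge_edge, h.exch_z, (a0 i).2.1]
  · rcases h.odd with rfl | rfl
    · right; decide
    · left; decide
  · rcases h.even with rfl | rfl
    · right; decide
    · left; decide
  · intro m
    simp only [Equiv.symm_apply_apply, Prod.mk.eta, h.invol, Equiv.apply_symm_apply]
  · simp only [Equiv.symm_apply_apply, h.exch_x', (a0 j).1]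
  · simp only [Equiv.symm_apply_apply, h.exch_x, (a0 j).2.1, (a0 i).2.2]
  · simp only [Equiv.symm_apply_apply, h.exch_y', (a0 k).1]
  · simp only [Equiv.symm_apply_apply, h.exch_y, (a0 k).2.1, (a0 j).2.2]
  · simp only [Equiv.symm_apply_apply, h.exch_z', (a0 i).1]
  · simp only [Equiv.symm_apply_apply, h.exch_z, (a0 i).2.1, (a0 k).2.2]
  · intro m h1 h2 h3
    rw [h.exch_ne (f.symm m.1, m.2)]
    · simp
    · rintro rfl; simp at h1
    · rintro rfl; simp at h2
    · rintro rfl; simp at h3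
  · intro m
    have := h.edge_exch (e (f.symm m.1, m.2))
    obtain ⟨⟨w, l⟩, rfl⟩ : ∃ n : Dart D₁.Crossing, m = (f n.1, n.2) := ⟨(f.symm m.1, m.2), by simp⟩
    simp only [Equiv.symm_apply_apply]
    have h1 := he (w, l)
    rw [h1]
    simp only [Equiv.symm_apply_apply, h.invol]

variable {A : Type} [AddCommGroup A]

open Classical in
/-- The coloring after a third Reidemeister move: the colors at `z` are reflected at the color of
the top strand. -/
noncomputable def transfer (x y z : D₁.Crossing) (i j k : ZMod 4) (g : Dart D₁.Crossing → A) : Dart D₁.Crossing → A :=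
  fun d =>
    if d.1 = z then g (x, i) + g (x, i) - g d
    else if d.1 = x then cyclicColors i (g (x, i)) (g (z, k + 2)) (g (x, i))
      (g (x, i) + g (x, i) - g (z, k + 2)) d.2
    else if d.1 = y then cyclicColors j (g (z, k + 3)) (g (x, i))
      (g (x, i) + g (x, i) - g (z, k + 3)) (g (x, i)) d.2
    else g d

theorem transfer_z (x y z : D₁.Crossing) (i j k : ZMod 4) (g : Dart D₁.Crossing → A)
    (l : ZMod 4) : transfer x y z i j k g (z, l) = g (x, i) + g (x, i) - g (z, l) := by
  rw [transfer, if_pos rfl]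

theorem transfer_x (h : IsTriangleMove D₁ D₂ f x y z i j k e) (g : Dart D₁.Crossing → A)
    (l : ZMod 4) :
    transfer x y z i j k g (x, l) = cyclicColors i (g (x, i)) (g (z, k + 2)) (g (x, i))
      (g (x, i) + g (x, i) - g (z, k + 2)) l := by
  rw [transfer, if_neg h.ne_zx.symm, if_pos rfl]

theorem transfer_y (h : IsTriangleMove D₁ D₂ f x y z i j k e) (g : Dart D₁.Crossing → A)
    (l : ZMod 4) :
    transfer x y z i j k g (y, l) = cyclicColors j (g (z, k + 3)) (g (x, i))
      (g (x, i) + g (x, i) - g (z, k + 3)) (g (x, i)) l := by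
  rw [transfer, if_neg h.ne_yz, if_neg h.ne_xy.symm, if_pos rfl]

theorem transfer_of_ne {d : Dart D₁.Crossing} (hx : d.1 ≠ x) (hy : d.1 ≠ y) (hz : d.1 ≠ z)
    (g : Dart D₁.Crossing → A) : transfer x y z i j k g d = g d := by
  rw [transfer, if_neg hz, if_neg hx, if_neg hy]

/-- The relations among the colors on the three crossings of the triangle. -/
theorem colors (h : IsTriangleMove D₁ D₂ f x y z i j k e) {g : Dart D₁.Crossing → A}
    (hg : IsDartColoring D₁.edge g) :
    g (x, i + 2) = g (x, i) ∧ g (x, i + 3) = g (x, i) + g (x, i) - g (x, i + 1) ∧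
    g (y, j + 1) = g (x, i) ∧ g (y, j + 3) = g (x, i) ∧
    g (y, j + 2) = g (x, i) + g (x, i) - g (y, j) ∧
    g (z, k + 1) = g (y, j) ∧ g (x, i + 1) = g (z, k) := by
  have e1 := hg.edge_eq (x, i)
  have e2 := hg.edge_eq (y, j)
  have e3 := hg.edge_eq (z, k)
  rw [h.edge_x] at e1
  rw [h.edge_y] at e2
  rw [h.edge_z] at e3
  obtain ⟨x1, x2⟩ := (isCrossingColoring_iff_of_odd h.odd).1 (hg.crossing x)
  obtain ⟨y1, y2⟩ := (isCrossingColoring_iff_of_even h.even).1 (hg.crossing y)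
  rw [e1] at y1 y2
  exact ⟨x1.symm, eq_sub_of_add_eq' x2, e1, y1.symm, eq_sub_of_add_eq' y2, e2, e3⟩

/-- Outside the triangle nothing changes: an outer dart keeps its color when `e` puts it in its new
place. -/
theorem transfer_exch (h : IsTriangleMove D₁ D₂ f x y z i j k e) {g : Dart D₁.Crossing → A}
    (hg : IsDartColoring D₁.edge g) (m : Dart D₁.Crossing) (h1 : m ≠ (x, i))
    (h2 : m ≠ (x, i + 1)) (h3 : m ≠ (y, j)) (h4 : m ≠ (y, j + 1)) (h5 : m ≠ (z, k))
    (h6 : m ≠ (z, k + 1)) : transfer x y z i j k g (e m) = g m := by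
  obtain ⟨c1, c2, c3, c4, c5, c6, c7⟩ := h.colors hg
  obtain ⟨w, l⟩ := m
  by_cases hwx : w = x
  · subst hwx
    rcases zmod_four_exhaust i l with rfl | rfl | rfl | rfl
    · exact absurd rfl h1
    · exact absurd rfl h2
    · rw [h.exch_x', h.transfer_y, cyclicColors_one, c1]
    · rw [← h.exch_z, h.invol, transfer_z, h.exch_z, c2, c7]
  by_cases hwy : w = y
  · subst hwy
    rcases zmod_four_exhaust j l with rfl | rfl | rfl | rfl
    · exact absurd rfl h3
    · exact absurd rfl h4
    · rw [h.exch_y', transfer_z, c5, c6]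
    · rw [← h.exch_x, h.invol, h.transfer_x, cyclicColors_zero, h.exch_x, c4]
  by_cases hwz : w = z
  · subst hwz
    rcases zmod_four_exhaust k l with rfl | rfl | rfl | rfl
    · exact absurd rfl h5
    · exact absurd rfl h6
    · rw [h.exch_z', h.transfer_x, cyclicColors_one]
    · rw [← h.exch_y, h.invol, h.transfer_y, cyclicColors_zero, h.exch_y]
  · rw [h.exch_ne (w, l) hwx hwy hwz, transfer_of_ne hwx hwy hwz]

theorem transfer_exch_edge (h : IsTriangleMove D₁ D₂ f x y z i j k e)
    {g : Dart D₁.Crossing → A} (hg : IsDartColoring D₁.edge g) (m : Dart D₁.Crossing) :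
    transfer x y z i j k g (e (D₁.edge m)) = transfer x y z i j k g (e m) := by
  have hx3 : e (y, j + 1) = (x, i + 2) := by rw [← h.exch_x', h.invol]
  have hy3 : e (z, k + 1) = (y, j + 2) := by rw [← h.exch_y', h.invol]
  have hz3 : e (x, i + 1) = (z, k + 2) := by rw [← h.exch_z', h.invol]
  have s1 : transfer x y z i j k g (e (y, j + 1)) = transfer x y z i j k g (e (x, i)) := by
    rw [hx3, h.exch_x, h.transfer_x, h.transfer_y, cyclicColors_two, cyclicColors_three]
  have s2 : transfer x y z i j k g (e (z, k + 1)) = transfer x y z i j k g (e (y, j)) := by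
    rw [hy3, h.exch_y, h.transfer_y, transfer_z, cyclicColors_two]
  have s3 : transfer x y z i j k g (e (x, i + 1)) = transfer x y z i j k g (e (z, k)) := by
    rw [hz3, h.exch_z, h.transfer_x, transfer_z, cyclicColors_three]
  have u1 : D₁.edge (y, j + 1) = (x, i) := by rw [← h.edge_x, D₁.edge_edge]
  have u2 : D₁.edge (z, k + 1) = (y, j) := by rw [← h.edge_y, D₁.edge_edge]
  have u3 : D₁.edge (x, i + 1) = (z, k) := by rw [← h.edge_z, D₁.edge_edge]
  have back : ∀ a b : Dart D₁.Crossing, D₁.edge a = b → D₁.edge m = b → m = a := by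
    rintro a b h1 h2
    exact D₁.edge.injective (h2.trans h1.symm)
  by_cases h1 : m = (x, i)
  · rw [h1, h.edge_x, s1]
  by_cases h2 : m = (x, i + 1)
  · rw [h2, u3, s3]
  by_cases h3 : m = (y, j)
  · rw [h3, h.edge_y, s2]
  by_cases h4 : m = (y, j + 1)
  · rw [h4, u1, s1]
  by_cases h5 : m = (z, k)
  · rw [h5, h.edge_z, s3]
  by_cases h6 : m = (z, k + 1)
  · rw [h6, u2, s2]
  rw [h.transfer_exch hg m h1 h2 h3 h4 h5 h6, h.transfer_exch hg, hg.edge_eq]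
  · exact fun hm => h4 (back _ _ u1 hm)
  · exact fun hm => h5 (back _ _ h.edge_z hm)
  · exact fun hm => h6 (back _ _ u2 hm)
  · exact fun hm => h1 (back _ _ h.edge_x hm)
  · exact fun hm => h2 (back _ _ u3 hm)
  · exact fun hm => h3 (back _ _ h.edge_y hm)

/-- At `z` the colors are reflected at the color of the top strand, and reflections preserve the Fox
relation. At `x` and `y` the relation is built into the chosen colors. -/
theorem isCrossingColoring_transfer (h : IsTriangleMove D₁ D₂ f x y z i j k e)
    {g : Dart D₁.Crossing → A} (hg : IsDartColoring D₁.edge g) (w : D₁.Crossing) :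
    IsCrossingColoring fun l => transfer x y z i j k g (w, l) := by
  by_cases hwx : w = x
  · subst hwx
    simp only [h.transfer_x]
    rw [isCrossingColoring_iff_of_odd h.odd, cyclicColors_zero, cyclicColors_one,
      cyclicColors_two, cyclicColors_three]
    exact ⟨rfl, by abel⟩
  by_cases hwy : w = y
  · subst hwy
    simp only [h.transfer_y]
    rw [isCrossingColoring_iff_of_even h.even, cyclicColors_zero, cyclicColors_one,
      cyclicColors_two, cyclicColors_three]
    exact ⟨rfl, by abel⟩
  by_cases hwz : w = z
  · subst hwz
    simp only [transfer_z]
    obtain ⟨h1, h2⟩ := hg.crossing w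
    dsimp only at h1 h2
    refine ⟨congrArg (g (x, i) + g (x, i) - ·) h1, ?_⟩
    have : ∀ a b c d : A, b + c = d + d → a - b + (a - c) = a - d + (a - d) := by
      intro a b c d hbc
      calc a - b + (a - c) = a + a - (b + c) := by abel
        _ = _ := by rw [hbc]; abel
    exact this _ _ _ _ h2
  · have := hg.crossing w
    refine (iff_of_eq (congrArg _ (funext fun l => ?_))).2 this
    exact transfer_of_ne hwx hwy hwz g

theorem transfer_injective (h : IsTriangleMove D₁ D₂ f x y z i j k e)
    {g g' : Dart D₁.Crossing → A} (hg : IsDartColoring D₁.edge g)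
    (hg' : IsDartColoring D₁.edge g')
    (heq : transfer x y z i j k g = transfer x y z i j k g') : g = g' := by
  obtain ⟨c1, c2, c3, c4, c5, c6, c7⟩ := h.colors hg
  obtain ⟨c1', c2', c3', c4', c5', c6', c7'⟩ := h.colors hg'
  have ha : g (x, i) = g' (x, i) := by
    have := congrFun heq (x, i)
    rwa [h.transfer_x, h.transfer_x, cyclicColors_zero, cyclicColors_zero] at this
  have hz : ∀ l, g (z, l) = g' (z, l) := by
    intro l
    have := congrFun heq (z, l)
    rw [transfer_z, transfer_z, ha] at this
    exact sub_right_inj.1 this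
  funext ⟨w, l⟩
  by_cases hwx : w = x
  · subst hwx
    rcases zmod_four_exhaust i l with rfl | rfl | rfl | rfl
    · exact ha
    · rw [c7, c7', hz]
    · rw [c1, c1', ha]
    · rw [c2, c2', c7, c7', hz, ha]
  by_cases hwy : w = y
  · subst hwy
    rcases zmod_four_exhaust j l with rfl | rfl | rfl | rfl
    · rw [← c6, ← c6', hz]
    · rw [c3, c3', ha]
    · rw [c5, c5', ← c6, ← c6', hz, ha]
    · rw [c4, c4', ha]
  by_cases hwz : w = z
  · subst hwz
    exact hz l
  · have := congrFun heq (w, l)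
    rwa [transfer_of_ne hwx hwy hwz, transfer_of_ne hwx hwy hwz] at this

/-- Injectivity suffices, since the opposite inequality is the same statement for the inverse move.
Comparing cardinals needs `A` finite. -/
theorem card_le (h : IsTriangleMove D₁ D₂ f x y z i j k e) [Finite A] :
    Nat.card {g : Dart D₁.Crossing → A // IsDartColoring D₁.edge g} ≤
      Nat.card {g : Dart D₂.Crossing → A // IsDartColoring D₂.edge g} := by
  refine Nat.card_le_card_of_injective
    (fun g => ⟨fun d => transfer x y z i j k g.1 (f.symm d.1, d.2), fun d => ?_, fun w => ?_⟩) ?_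
  · obtain ⟨m, rfl⟩ : ∃ m, d = (f (e m).1, (e m).2) :=
      ⟨e (f.symm d.1, d.2), by rw [h.invol]; simp⟩
    rw [h.edge_exch]
    simpa using h.transfer_exch_edge g.2 m
  · exact h.isCrossingColoring_transfer g.2 _
  · rintro ⟨g, hg⟩ ⟨g', hg'⟩ heq
    refine Subtype.ext (h.transfer_injective hg hg' (funext fun d => ?_))
    have := congrFun (Subtype.mk.inj heq) (f d.1, d.2)
    simpa using this

end IsTriangleMove

theorem IsR3.colCount_eq {D₁ D₂ : LinkDiagram} (A : Type) [AddCommGroup A] [Finite A]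
    (h : IsR3 D₁ D₂) : D₁.colCount A = D₂.colCount A := by
  obtain ⟨f, x, y, z, i, j, k, e, h⟩ := h.exists_isTriangleMove
  unfold colCount
  rw [h.loops, le_antisymm h.card_le h.symm.card_le]

theorem SameLink.colCount_eq {D₁ D₂ : LinkDiagram} (A : Type) [AddCommGroup A] [Finite A]
    (h : SameLink D₁ D₂) : D₁.colCount A = D₂.colCount A := by
  induction h with
  | rel D₁ D₂ h =>
    rcases h with h | h | h | h | h
    · exact h.colCount_eq A
    · exact h.colCount_eq A
    · exact h.colCount_eq A
    · exact h.colCount_eq A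
    · exact h.colCount_eq A
  | refl => rfl
  | symm _ _ _ ih => exact ih.symm
  | trans _ _ _ _ _ ih₁ ih₂ => exact ih₁.trans ih₂

/-- The unknot has only constant Fox colorings. -/
theorem IsUnknot.eq_of_isDartColoring {D : LinkDiagram} (hD : IsUnknot D) (hloops : D.loops = 0)
    {A : Type} [AddCommGroup A] [Finite A] {g : Dart D.Crossing → A}
    (hg : IsDartColoring D.edge g) (a b : Dart D.Crossing) : g a = g b := by
  have hcircle : circle.colCount A = Nat.card A := by
    have h1 : Nat.card {g : Dart circle.Crossing → A // IsDartColoring circle.edge g} = 1 := by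
      rw [Nat.card_eq_one_iff_unique]
      refine ⟨⟨fun g g' => Subtype.ext (funext fun d => d.1.elim)⟩,
        ⟨fun d => d.1.elim, fun d => d.1.elim, fun x => x.elim⟩⟩
    have h2 : circle.loops = 1 := rfl
    rw [colCount, h1, h2, one_mul, pow_one]
  have hcard := SameLink.colCount_eq A hD
  rw [hcircle, colCount, hloops, pow_zero, mul_one] at hcard
  have hinj : Function.Injective (fun c : A =>
      (⟨fun _ => c, isDartColoring_const D.edge c⟩ :
        {g : Dart D.Crossing → A // IsDartColoring D.edge g})) := by
    intro c c' hcc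
    exact congrFun (Subtype.mk.inj hcc) a
  -- The constant colorings already account for all `Nat.card A` colorings.
  have hbij := (Nat.bijective_iff_injective_and_card _).2 ⟨hinj, hcard.symm⟩
  obtain ⟨c, hc⟩ := hbij.2 ⟨g, hg⟩
  have hc' := Subtype.mk.inj hc
  rw [← hc']

/-! ### Arcs with the same class in the universal coloring group -/

section Arcs

variable (D : LinkDiagram) {A : Type} [AddCommGroup A]

theorem arc_edge (d : Dart D.Crossing) : D.arc (D.edge d) = D.arc d :=
  (congrArg Sum.inl (Quot.sound (ArcStep.edge d))).symm

theorem arc_over (x : D.Crossing) : D.arc (x, 1) = D.arc (x, 3) :=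
  congrArg Sum.inl (Quot.sound (ArcStep.over x))

theorem exists_arc_eq (hloops : D.loops = 0) (a : D.Arc) : ∃ d, D.arc d = a := by
  rcases a with q | i
  · obtain ⟨d, rfl⟩ := Quot.exists_rep q
    exact ⟨d, rfl⟩
  · rw [hloops] at i; exact i.elim0

/-- A function on the darts that is constant along arcs, as a function on the arcs. -/
def arcLift (u : Dart D.Crossing → A) (h₁ : ∀ d, u (D.edge d) = u d)
    (h₂ : ∀ x, u (x, 1) = u (x, 3)) : D.Arc → A :=
  Sum.elim (Quot.lift u (by
    intro a b h
    cases h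
    · exact (h₁ _).symm
    · exact h₂ _)) fun _ => 0

/-- The universal coloring: every other one is its image under a homomorphism. -/
theorem isDartColoring_colArc : IsDartColoring D.edge fun d => D.colArc (D.arc d) := by
  refine ⟨fun d => by rw [arc_edge], fun x => ⟨congrArg D.colArc (D.arc_over x), ?_⟩⟩
  have h : (Submodule.Quotient.mk (colRelator D x) : D.Col) = 0 :=
    (Submodule.Quotient.mk_eq_zero _).2 (Submodule.subset_span ⟨x, rfl⟩)
  have h2 : Finsupp.single (D.arc (x, 1)) (2 : ℤ)
      = Finsupp.single (D.arc (x, 1)) 1 + Finsupp.single (D.arc (x, 1)) 1 := by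
    rw [← Finsupp.single_add]; norm_num
  rw [colRelator, h2, Submodule.Quotient.mk_sub, Submodule.Quotient.mk_sub,
    Submodule.Quotient.mk_add, sub_sub, sub_eq_zero] at h
  exact h.symm

theorem IsDartColoring.comp {X B : Type} [AddCommGroup B] {edge : Equiv.Perm (Dart X)}
    {g : Dart X → A} (hg : IsDartColoring edge g) (φ : A →+ B) :
    IsDartColoring edge fun d => φ (g d) := by
  refine ⟨fun d => by rw [hg.edge_eq], fun x => ?_⟩
  obtain ⟨h1, h2⟩ := hg.crossing x
  exact ⟨congrArg φ h1, by rw [← map_add, ← map_add]; exact congrArg φ h2⟩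

theorem exists_hom_of_isDartColoring {g : Dart D.Crossing → A} (hg : IsDartColoring D.edge g) :
    ∃ φ : D.Col →ₗ[ℤ] A, ∀ d, φ (D.colArc (D.arc d)) = g d := by
  let u := D.arcLift g hg.edge_eq fun x => (hg.crossing x).1
  have hu : ∀ d, u (D.arc d) = g d := fun d => rfl
  refine ⟨Submodule.liftQ _ (Finsupp.linearCombination ℤ u) ?_, fun d => ?_⟩
  · rw [Submodule.span_le]
    rintro _ ⟨x, rfl⟩
    rw [SetLike.mem_coe, LinearMap.mem_ker, colRelator, map_sub, map_sub,
      Finsupp.linearCombination_single, Finsupp.linearCombination_single,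
      Finsupp.linearCombination_single, hu, hu, hu, one_smul, one_smul, two_smul, sub_sub,
      sub_eq_zero]
    exact (hg.crossing x).2.symm
  · change Finsupp.linearCombination ℤ u (Finsupp.single (D.arc d) 1) = _
    rw [Finsupp.linearCombination_single, one_smul, hu]

theorem arc_eq_arc_one {d : Dart D.Crossing} (hd : IsOver d) : D.arc d = D.arc (d.1, 1) := by
  obtain ⟨x, i⟩ := d
  rcases hd with h | h <;> dsimp only at h <;> subst h
  · rfl
  · exact (D.arc_over x).symm

open Classical in
/-- The crossing at which the arc of a dart passes over, in an alternating diagram. -/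
noncomputable def overCrossing (d : Dart D.Crossing) : D.Crossing :=
  if IsOver d then d.1 else (D.edge d).1

/-- In an alternating diagram each arc passes over one crossing, which serves as its label. -/
theorem arc_overCrossing (halt : D.Alternating) (d : Dart D.Crossing) :
    D.arc d = D.arc (D.overCrossing d, 1) := by
  unfold overCrossing
  split_ifs with h
  · exact D.arc_eq_arc_one h
  · rw [← D.arc_edge, D.arc_eq_arc_one ((halt d).2 h)]

theorem overCrossing_edge (halt : D.Alternating) (d : Dart D.Crossing) :
    D.overCrossing (D.edge d) = D.overCrossing d := by
  unfold overCrossing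
  rw [D.edge_edge]
  by_cases h : IsOver d
  · rw [if_pos h, if_neg (by rw [halt, not_not]; exact h)]
  · rw [if_neg h, if_pos ((halt d).2 h)]

theorem overCrossing_of_isOver {d : Dart D.Crossing} (h : IsOver d) : D.overCrossing d = d.1 :=
  if_pos h

theorem overCrossing_of_not_isOver {d : Dart D.Crossing} (h : ¬ IsOver d) :
    D.overCrossing d = (D.edge d).1 := if_neg h

-- The weights are the coefficients of the relators whose combination is the difference of the two
-- arcs. The equation compares the coefficients of the arc that is over at `c`.
open Classical in
theorem exists_weights_of_colArc_eq (halt : D.Alternating) {a b : Dart D.Crossing}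
    (hab : D.colArc (D.arc a) = D.colArc (D.arc b)) :
    ∃ v : D.Crossing → ℤ, ∀ c, 2 * v c - v (D.edge (c, 1)).1 - v (D.edge (c, 3)).1 =
      (if D.overCrossing a = c then 1 else 0) - (if D.overCrossing b = c then 1 else 0) := by
  have := Fintype.ofFinite D.Crossing
  have hmem := (Submodule.Quotient.eq _).1 hab
  rw [Submodule.mem_span_range_iff_exists_fun] at hmem
  obtain ⟨v, hv⟩ := hmem
  refine ⟨v, fun c => ?_⟩
  let φ : D.Crossing → ℤ := fun x => if x = c then 1 else 0
  let u := D.arcLift (fun d => φ (D.overCrossing d))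
    (fun d => by rw [D.overCrossing_edge halt])
    (fun x => by rw [D.overCrossing_of_isOver (isOver_one x),
      D.overCrossing_of_isOver (isOver_three x)])
  have hu : ∀ d, u (D.arc d) = φ (D.overCrossing d) := fun d => rfl
  have h1 := congrArg (Finsupp.linearCombination ℤ u) hv
  rw [map_sum, map_sub, Finsupp.linearCombination_single, Finsupp.linearCombination_single,
    one_smul, one_smul, hu, hu] at h1
  have h2 : ∀ x, Finsupp.linearCombination ℤ u (v x • colRelator D x) =
      2 * (v x * φ x) - (v x * φ (D.edge (x, 0)).1 + v x * φ (D.edge (x, 2)).1) := by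
    intro x
    rw [map_smul, colRelator, map_sub, map_sub, Finsupp.linearCombination_single,
      Finsupp.linearCombination_single, Finsupp.linearCombination_single, hu, hu, hu,
      D.overCrossing_of_isOver (isOver_one x), D.overCrossing_of_not_isOver (not_isOver_zero x),
      D.overCrossing_of_not_isOver (not_isOver_two x)]
    simp only [smul_eq_mul]
    ring
  -- Summing over under darts is rewritten, through `edge`, as summing over the over darts at their
  -- other ends.
  have h3 : ∑ x, (v x * φ (D.edge (x, 0)).1 + v x * φ (D.edge (x, 2)).1) =
      ∑ x, (v (D.edge (x, 1)).1 * φ x + v (D.edge (x, 3)).1 * φ x) := by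
    have h4 := Equiv.sum_comp D.edge
      fun d => if IsOver d then 0 else v d.1 * φ (D.edge d).1
    rw [sum_dart, sum_dart] at h4
    simp only [halt _, not_isOver_zero, isOver_one, not_isOver_two, isOver_three, if_true,
      if_false, not_true_eq_false, not_false_eq_true, D.edge_edge, zero_add, add_zero] at h4
    exact h4.symm
  rw [Finset.sum_congr rfl fun x _ => h2 x, Finset.sum_sub_distrib, h3,
    ← Finset.sum_sub_distrib] at h1
  rw [← h1, Finset.sum_eq_single c]
  · simp only [φ, if_true]; ring
  · intro x _ hx
    simp only [φ, if_neg hx]; ring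
  · intro h; exact absurd (Finset.mem_univ c) h

/-- If two arcs of a connected alternating diagram have the same class in the universal coloring
group, then the diagram has a cut that meets only two edges. -/
theorem exists_isCut_of_colArc_eq (halt : D.Alternating) (hconn : IsConnectedMap D.edge)
    {a b : Dart D.Crossing} (hne : D.arc a ≠ D.arc b)
    (hab : D.colArc (D.arc a) = D.colArc (D.arc b)) :
    ∃ M p s, IsCut D.edge M p s := by
  classical
  obtain ⟨v, hv⟩ := D.exists_weights_of_colArc_eq halt hab
  have hω : D.overCrossing a ≠ D.overCrossing b := by
    intro h
    exact hne (by rw [D.arc_overCrossing halt a, D.arc_overCrossing halt b, h])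
  set x := D.overCrossing a
  set y := D.overCrossing b
  have : Nonempty D.Crossing := ⟨x⟩
  -- The cut will be the boundary of the set where `v` attains its maximum.
  obtain ⟨m, hm⟩ := Finite.exists_max v
  have hQ : ∀ (x : D.Crossing) (i : ZMod 4), IsOver (x, i + 1) ↔ ¬ IsOver (x, i) :=
    isOver_add_one
  have hvx := hv x
  rw [if_pos rfl, if_neg hω.symm] at hvx
  -- away from `x`, the maximum spreads along over-strands
  have hspread : ∀ c, v c = v m → c ≠ x →
      v (D.edge (c, 1)).1 = v m ∧ v (D.edge (c, 3)).1 = v m := by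
    intro c hc hcx
    have h1 := hv c
    rw [if_neg hcx.symm] at h1
    have h2 := hm (D.edge (c, 1)).1
    have h3 := hm (D.edge (c, 3)).1
    -- At `c = y` the neighbors would sum to more than twice the maximum; elsewhere both must be
    -- maximal.
    split_ifs at h1 <;> constructor <;> omega
  have hover : ∀ (P : Dart D.Crossing → Prop) (c : D.Crossing), P (c, 1) → P (c, 3) →
      ∀ d : Dart D.Crossing, d.1 = c → IsOver d → P d := by
    rintro P c h1 h3 ⟨_, i⟩ rfl (h | h) <;> dsimp only at h <;> subst h <;> assumption
  have hcl : ∀ d : Dart D.Crossing, d.1 ∈ {c | v c = v m} → IsOver d → d.1 ≠ x →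
      (D.edge d).1 ∈ {c | v c = v m} := fun d hd ho hdx =>
    hover (fun d => v (D.edge d).1 = v m) d.1 (hspread _ hd hdx).1 (hspread _ hd hdx).2 d rfl ho
  have hcut : ∀ p : Dart D.Crossing, p.1 = x → v x = v m → IsOver p → v (D.edge p).1 ≠ v m →
      (∀ d : Dart D.Crossing, d.1 = x → IsOver d → d ≠ p → v (D.edge d).1 = v m) →
      ∃ M p s, IsCut D.edge M p s := by
    intro p hp hx ho hn hd
    have hpM : p.1 ∈ {c | v c = v m} := by rw [hp]; exact hx
    obtain ⟨s, h1, h2, h3⟩ := exists_unique_exit (Q := IsOver) hQ D.edge_edge halt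
      {c | v c = v m} p hpM ho hn (by
        intro d hdM hdo hdp
        by_cases hdx : d.1 = x
        · exact hd d hdx hdo hdp
        · exact hcl d hdM hdo hdx)
    exact ⟨_, p, s, hpM, h1, iff_of_true ho h2, h3⟩
  -- If `v x` is maximal, its two neighbors sum to twice the maximum minus one, so exactly one of
  -- them falls short and gives the only over exit. Otherwise the set has no exit at all, against
  -- connectedness.
  by_cases hx : v x = v m
  · have h2 := hm (D.edge (x, 1)).1
    have h3 := hm (D.edge (x, 3)).1
    by_cases h1 : v (D.edge (x, 1)).1 = v m
    · refine hcut (x, 3) rfl hx (isOver_three x) (by omega) ?_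
      exact hover (fun d => d ≠ (x, 3) → v (D.edge d).1 = v m) x (fun _ => h1)
        (fun h => absurd rfl h)
    · refine hcut (x, 1) rfl hx (isOver_one x) h1 ?_
      exact hover (fun d => d ≠ (x, 1) → v (D.edge d).1 = v m) x (fun h => absurd rfl h)
        (fun _ => by omega)
  · exfalso
    have huniv := hconn {c | v c = v m} ⟨m, rfl⟩
      (edge_mem_of_parity (Q := IsOver) hQ D.edge_edge halt _ (by
        intro d hd ho
        refine hcl d hd ho ?_
        intro hdx
        rw [hdx] at hd
        exact hx hd))
    have : x ∈ {c | v c = v m} := by rw [huniv]; trivial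
    exact hx this

/-- A Fox coloring of a connected alternating diagram by integers is constant. -/
theorem eq_of_isDartColoring_int (halt : D.Alternating) (hconn : IsConnectedMap D.edge)
    {g : Dart D.Crossing → ℤ} (hg : IsDartColoring D.edge g) (a b : Dart D.Crossing) :
    g a = g b := by
  have : Nonempty D.Crossing := ⟨a.1⟩
  obtain ⟨m, hm⟩ := Finite.exists_max fun x : D.Crossing => g (x, 1)
  have hover : ∀ d : Dart D.Crossing, IsOver d → g d = g (d.1, 1) := by
    rintro ⟨x, i⟩ (h | h) <;> dsimp only at h <;> subst h
    · rfl
    · exact (hg.crossing x).1.symm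
  have hle : ∀ d, g d ≤ g (m, 1) := by
    intro d
    by_cases ho : IsOver d
    · rw [hover d ho]; exact hm d.1
    · rw [← hg.edge_eq, hover _ ((halt d).2 ho)]; exact hm _
  have hall : ∀ x, g (x, 1) = g (m, 1) → ∀ i, g (x, i) = g (m, 1) := by
    intro x hx i
    obtain ⟨h1, h2⟩ := hg.crossing x
    dsimp only at h1 h2
    have h3 := hle (x, 0)
    have h4 := hle (x, 2)
    rcases zmod_four_exhaust 0 i with rfl | rfl | rfl | rfl
    · omega
    · exact hx
    · exact show g (x, 2) = _ by omega
    · exact h1.symm.trans hx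
  -- Where the over-color is maximal, both under-colors are too. Each under dart leads to the
  -- over-strand of its own arc, so the set is closed along under darts, and by parity along all.
  have huniv := hconn {x | g (x, 1) = g (m, 1)} ⟨m, rfl⟩
    (edge_mem_of_parity (Q := fun d => ¬ IsOver d) (fun x i => by rw [isOver_add_one])
      D.edge_edge (fun d => by rw [halt]) _ (by
        intro d hd ho
        change g ((D.edge d).1, 1) = _
        rw [← hover _ ((halt d).2 ho), hg.edge_eq]
        exact hall d.1 hd d.2))
  have key : ∀ d, g d = g (m, 1) := by
    intro d
    have : d.1 ∈ {x | g (x, 1) = g (m, 1)} := by rw [huniv]; trivial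
    exact hall d.1 this d.2
  exact (key a).trans (key b).symm

end Arcs

/-! ### The reduced coloring group -/

/-- The class of an arc in the reduced group of Fox colorings. -/
noncomputable def colRedArc (D : LinkDiagram) (base : D.Arc) : D.Arc → D.ColRed base :=
  fun x => Submodule.Quotient.mk (D.colArc x)

theorem colRedArc_base (D : LinkDiagram) (base : D.Arc) : D.colRedArc base base = 0 :=
  (Submodule.Quotient.mk_eq_zero _).2 (Submodule.mem_span_singleton_self _)

theorem isDartColoring_colRedArc (D : LinkDiagram) (base : D.Arc) :
    IsDartColoring D.edge fun d => D.colRedArc base (D.arc d) :=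
  D.isDartColoring_colArc.comp (Submodule.mkQ (Submodule.span ℤ {D.colArc base})).toAddMonoidHom

/-- The constant coloring by 1 defines a degree on `Col D`. A difference of two arcs has degree
zero, so the only multiple of the base arc it can equal is zero. -/
theorem colRedArc_eq_iff (D : LinkDiagram) (hloops : D.loops = 0) (base x y : D.Arc) :
    D.colRedArc base x = D.colRedArc base y ↔ D.colArc x = D.colArc y := by
  refine ⟨fun h => ?_, fun h => by rw [colRedArc, h, colRedArc]⟩
  obtain ⟨φ, hφ⟩ := D.exists_hom_of_isDartColoring (isDartColoring_const D.edge (1 : ℤ))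
  have hφ' : ∀ z, φ (D.colArc z) = 1 := by
    intro z
    obtain ⟨d, rfl⟩ := D.exists_arc_eq hloops z
    exact hφ d
  obtain ⟨m, hm⟩ := Submodule.mem_span_singleton.1 ((Submodule.Quotient.eq _).1 h)
  have h0 := congrArg φ hm
  rw [map_smul, map_sub, hφ', hφ', hφ', smul_eq_mul, mul_one, sub_self] at h0
  rw [h0, zero_smul] at hm
  exact (sub_eq_zero.1 hm.symm)

theorem colRed_hom_ext (D : LinkDiagram) (base : D.Arc) (φ : D.ColRed base →ₗ[ℤ] ℤ)
    (h : ∀ x, φ (D.colRedArc base x) = 0) : φ = 0 := by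
  ext x
  exact h x

/-- A homomorphism to ℤ is an integer coloring that vanishes at the base arc, hence zero. A finitely
generated abelian group with trivial dual is torsion, so it is finite. -/
theorem finite_colRed (D : LinkDiagram) (hloops : D.loops = 0)
    (hconst : ∀ g : Dart D.Crossing → ℤ, IsDartColoring D.edge g → ∀ a b, g a = g b)
    (base : D.Arc) : Finite (D.ColRed base) := by
  have hdual : ∀ φ : D.ColRed base →ₗ[ℤ] ℤ, φ = 0 := by
    intro φ
    refine D.colRed_hom_ext base φ fun x => ?_
    obtain ⟨a, rfl⟩ := D.exists_arc_eq hloops x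
    obtain ⟨b, hb⟩ := D.exists_arc_eq hloops base
    have := hconst _ ((D.isDartColoring_colRedArc base).comp φ.toAddMonoidHom) a b
    rw [hb, colRedArc_base, map_zero] at this
    exact this
  have htors : Module.IsTorsion ℤ (D.ColRed base) := by
    intro z
    rw [← Submodule.mem_torsion_iff, ← Submodule.Quotient.mk_eq_zero,
      ← Module.forall_dual_apply_eq_zero_iff ℤ]
    intro φ
    exact LinearMap.congr_fun (hdual (φ ∘ₗ Submodule.mkQ _)) z
  exact Module.finite_of_fg_torsion _ htors

/-! ### Colorings of a connected sum -/

section Sum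

variable {D₁ D₂ D : LinkDiagram} {h₁ : Dart D₁.Crossing} {h₂ : Dart D₂.Crossing}
  {f : D₁.Crossing ⊕ D₂.Crossing ≃ D.Crossing} {A : Type} [AddCommGroup A]

theorem sum_dart_cases (f : D₁.Crossing ⊕ D₂.Crossing ≃ D.Crossing) (d : Dart D.Crossing) :
    (∃ m : Dart D₁.Crossing, d = (f (Sum.inl m.1), m.2)) ∨
      ∃ m : Dart D₂.Crossing, d = (f (Sum.inr m.1), m.2) := by
  rcases dart_sum_cases f d with h | ⟨y, i, h⟩
  · exact Or.inl h
  · exact Or.inr ⟨(y, i), h⟩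

/-- Colorings of two diagrams that agree on the edges that are cut form a coloring of the
connected sum. -/
theorem IsSum.exists_isDartColoring (hD : IsSum D₁ D₂ h₁ h₂ D f) {g₁ : Dart D₁.Crossing → A}
    {g₂ : Dart D₂.Crossing → A} (hg₁ : IsDartColoring D₁.edge g₁)
    (hg₂ : IsDartColoring D₂.edge g₂) (h : g₁ h₁ = g₂ h₂) :
    ∃ g : Dart D.Crossing → A, IsDartColoring D.edge g ∧
      (∀ m : Dart D₁.Crossing, g (f (Sum.inl m.1), m.2) = g₁ m) ∧
      ∀ m : Dart D₂.Crossing, g (f (Sum.inr m.1), m.2) = g₂ m := by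
  obtain ⟨e1, e2, e3, e4, -⟩ := hD
  dsimp only at e1 e2 e3 e4
  let G : Dart D.Crossing → A := fun d =>
    Sum.elim (fun x => g₁ (x, d.2)) (fun x => g₂ (x, d.2)) (f.symm d.1)
  have hGl : ∀ m : Dart D₁.Crossing, G (f (Sum.inl m.1), m.2) = g₁ m := fun m => by simp [G]
  have hGr : ∀ m : Dart D₂.Crossing, G (f (Sum.inr m.1), m.2) = g₂ m := fun m => by simp [G]
  refine ⟨G, ⟨fun d => ?_, fun x => ?_⟩, hGl, hGr⟩
  · rcases sum_dart_cases f d with ⟨m, rfl⟩ | ⟨m, rfl⟩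
    · by_cases k1 : m = h₁
      · rw [k1, e1, hGl, hGr, h]
      by_cases k2 : m = D₁.edge h₁
      · rw [k2, e2, hGl, hGr, hg₁.edge_eq, hg₂.edge_eq, h]
      · rw [e3 m k1 k2, hGl, hGl, hg₁.edge_eq]
    · by_cases k1 : m = h₂
      · rw [k1, ← e1, D.edge_edge, e1, hGl, hGr, h]
      by_cases k2 : m = D₂.edge h₂
      · rw [k2, ← e2, D.edge_edge, e2, hGl, hGr, hg₁.edge_eq, hg₂.edge_eq, h]
      · rw [e4 m k1 k2, hGr, hGr, hg₂.edge_eq]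
  · obtain ⟨w, rfl⟩ := f.surjective x
    rcases w with x | x
    · have := hg₁.crossing x
      simpa only [← hGl (x, _)] using this
    · have := hg₂.crossing x
      simpa only [← hGr (x, _)] using this

open Classical in
/-- If the Fox relations hold at all crossings of an alternating diagram and the colors agree along
all edges but one, then they agree along that edge. -/
theorem eq_of_edge_eq_of_ne (halt : D.Alternating) {g : Dart D.Crossing → A}
    (hg : ∀ x, IsCrossingColoring fun i => g (x, i)) (h : Dart D.Crossing)
    (hedge : ∀ d, d ≠ h → d ≠ D.edge h → g (D.edge d) = g d) : g (D.edge h) = g h := by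
  have := Fintype.ofFinite D.Crossing
  -- The over colors and the under colors at each crossing have the same sum, so the differences
  -- along all edges, taken from over to under, add up to zero. Only the exceptional edge can
  -- contribute.
  have hsum : ∑ d, (if IsOver d then g d - g (D.edge d) else 0) = 0 := by
    have h1 : ∀ d, (if IsOver d then g d - g (D.edge d) else 0)
        = (if IsOver d then g d else 0) - (if IsOver d then g (D.edge d) else 0) := by
      intro d; split_ifs <;> simp
    rw [Finset.sum_congr rfl fun d _ => h1 d, Finset.sum_sub_distrib, sub_eq_zero]
    have h2 := Equiv.sum_comp D.edge fun d => if IsOver d then g (D.edge d) else 0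
    rw [← h2, sum_dart, sum_dart]
    refine Finset.sum_congr rfl fun x _ => ?_
    simp only [halt _, D.edge_edge, not_isOver_zero, isOver_one, not_isOver_two, isOver_three,
      if_true, if_false, not_true_eq_false, not_false_eq_true, zero_add, add_zero]
    obtain ⟨k1, k2⟩ := hg x
    dsimp only at k1 k2
    rw [k2, ← k1]
  -- the dart of the exceptional edge that is over
  obtain ⟨c, hc, hcd⟩ : ∃ c, IsOver c ∧ (c = h ∨ c = D.edge h) := by
    by_cases ho : IsOver h
    · exact ⟨h, ho, Or.inl rfl⟩
    · exact ⟨D.edge h, (halt h).2 ho, Or.inr rfl⟩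
  have hzero : ∀ d, d ≠ c → (if IsOver d then g d - g (D.edge d) else 0) = 0 := by
    intro d hd
    split_ifs with ho
    · rw [hedge, sub_self]
      · rintro rfl
        rcases hcd with rfl | rfl
        · exact hd rfl
        · exact (halt d).1 hc ho
      · rintro rfl
        rcases hcd with rfl | rfl
        · exact (halt c).1 ho hc
        · exact hd rfl
    · rfl
  rw [Finset.sum_eq_single c (fun d _ hd => hzero d hd)
    (fun hn => absurd (Finset.mem_univ c) hn), if_pos hc, sub_eq_zero] at hsum
  rcases hcd with rfl | rfl
  · exact hsum.symm
  · rwa [D.edge_edge] at hsum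

/-- A coloring of a connected sum with an alternating diagram restricts to the two summands. -/
theorem IsSum.isDartColoring_restrict (hD : IsSum D₁ D₂ h₁ h₂ D f) (halt : D₂.Alternating)
    {g : Dart D.Crossing → A} (hg : IsDartColoring D.edge g) :
    IsDartColoring D₁.edge (fun m => g (f (Sum.inl m.1), m.2)) ∧
      IsDartColoring D₂.edge fun m => g (f (Sum.inr m.1), m.2) := by
  obtain ⟨e1, e2, e3, e4, -⟩ := hD
  dsimp only at e1 e2 e3 e4
  have k1 := hg.edge_eq (f (Sum.inl h₁.1), h₁.2)
  have k2 := hg.edge_eq (f (Sum.inl (D₁.edge h₁).1), (D₁.edge h₁).2)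
  rw [e1] at k1
  rw [e2] at k2
  have hr : ∀ m, m ≠ h₂ → m ≠ D₂.edge h₂ →
      g (f (Sum.inr (D₂.edge m).1), (D₂.edge m).2) = g (f (Sum.inr m.1), m.2) := by
    intro m n1 n2
    rw [← e4 m n1 n2, hg.edge_eq]
  -- Only the cut edge of `D₂` is in doubt. Once its two ends agree, so do those of the cut edge of
  -- `D₁`.
  have key := eq_of_edge_eq_of_ne halt (g := fun m => g (f (Sum.inr m.1), m.2))
    (fun x => hg.crossing _) h₂ hr
  refine ⟨⟨fun m => ?_, fun x => hg.crossing _⟩, ⟨fun m => ?_, fun x => hg.crossing _⟩⟩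
  · by_cases n1 : m = h₁
    · rw [n1, ← k1, ← k2, key]
    by_cases n2 : m = D₁.edge h₁
    · rw [n2, D₁.edge_edge, ← k1, ← k2, key]
    · rw [← e3 m n1 n2, hg.edge_eq]
  · by_cases n1 : m = h₂
    · rw [n1, key]
    by_cases n2 : m = D₂.edge h₂
    · rw [n2, D₂.edge_edge, key]
    · exact hr m n1 n2

end Sum

/-! ### Reduced alternating diagrams of prime links -/

/-- With a single crossing, alternation forces an edge between neighboring positions, and this kink
is nugatory. -/
theorem nontrivial_crossing (D : LinkDiagram) [Nonempty D.Crossing] (halt : D.Alternating)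
    (hred : D.Reduced) : Nontrivial D.Crossing := by
  by_contra hn
  rw [not_nontrivial_iff_subsingleton] at hn
  let x : D.Crossing := Classical.arbitrary _
  have ho : IsOver (D.edge (x, 0)) := (halt _).2 (not_isOver_zero x)
  have hstep : ∀ d : Dart D.Crossing, D.SameFace d (facePerm D.edge d) := fun d =>
    Equiv.Perm.sameCycle_apply_right.2 (Equiv.Perm.SameCycle.refl _ _)
  rcases ho with h | h
  · have he : D.edge (x, 0) = (x, 1) := Prod.ext (Subsingleton.elim _ _) h
    have he' : D.edge (x, 1) = (x, 0) := by rw [← he, D.edge_edge]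
    have := hstep (x, 1)
    rw [facePerm_apply, he'] at this
    exact hred x 1 this
  · have he : D.edge (x, 0) = (x, 3) := Prod.ext (Subsingleton.elim _ _) h
    have := hstep (x, 0)
    rw [facePerm_apply, he] at this
    exact hred x 0 this

/-- `overCrossing` is constant along arcs and tells the two apart. -/
theorem arc_one_ne (D : LinkDiagram) (halt : D.Alternating) {x y : D.Crossing} (hxy : x ≠ y) :
    D.arc (x, 1) ≠ D.arc (y, 1) := by
  classical
  let u := D.arcLift (fun d => if D.overCrossing d = x then (1 : ℤ) else 0)
    (fun d => by rw [D.overCrossing_edge halt])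
    (fun x => by rw [D.overCrossing_of_isOver (isOver_one x),
      D.overCrossing_of_isOver (isOver_three x)])
  have hu : ∀ d, u (D.arc d) = if D.overCrossing d = x then (1 : ℤ) else 0 := fun d => rfl
  intro h
  have := congrArg u h
  rw [hu, hu, D.overCrossing_of_isOver (isOver_one x), D.overCrossing_of_isOver (isOver_one y),
    if_pos rfl, if_neg hxy.symm] at this
  exact one_ne_zero this

/-- A connected reduced alternating diagram with a crossing has a nonconstant Fox coloring. -/
theorem exists_nonconstant_isDartColoring (n : ℕ) : ∀ (D : LinkDiagram),
    Nat.card D.Crossing = n → Nonempty D.Crossing → D.loops = 0 → D.Alternating → D.Reduced →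
    IsConnectedMap D.edge →
    ∃ (A : Type) (_ : AddCommGroup A) (_ : Finite A) (g : Dart D.Crossing → A)
      (a b : Dart D.Crossing), IsDartColoring D.edge g ∧ g a ≠ g b := by
  induction n using Nat.strong_induction_on with
  | _ n ih =>
  intro D hn hne hloops halt hred hconn
  obtain ⟨x, y, hxy⟩ := (D.nontrivial_crossing halt hred).exists_pair_ne
  have harc := D.arc_one_ne halt hxy
  -- Equal classes give a cut with a smaller diagram, whose nonconstant coloring extends by a
  -- constant. Different classes are told apart in the finite group `ColRed` by its universal
  -- coloring.
  by_cases hcol : D.colArc (D.arc (x, 1)) = D.colArc (D.arc (y, 1))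
  · obtain ⟨M, p, s, h⟩ := D.exists_isCut_of_colArc_eq halt hconn harc hcol
    have hcard : Nat.card M < n := by
      rw [← hn, Nat.card_coe_set_eq, ← Set.ncard_univ]
      exact Set.ncard_lt_ncard (Set.ssubset_univ_iff.2 fun hM =>
        h.edge_left_notMem (by rw [hM]; trivial))
    obtain ⟨A, _, hfin, g, a, b, hg, hab⟩ := ih _ hcard (D.cutSummand h halt hconn) rfl
      ⟨⟨p.1, h.left_mem⟩⟩ rfl (D.cutSummand_alternating h halt hconn)
      (D.cutSummand_reduced h halt hconn hred) (D.cutSummand_isConnectedMap h halt hconn)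
    obtain ⟨G, hG, hGl, -⟩ := (D.isSum_cutSummand h halt hconn hloops).exists_isDartColoring hg
      (isDartColoring_const _ _) rfl
    exact ⟨A, _, hfin, G, _, _, hG, fun heq => hab ((hGl a).symm.trans (heq.trans (hGl b)))⟩
  · refine ⟨D.ColRed (D.arc (x, 1)), inferInstance,
      D.finite_colRed hloops (fun g hg a b => D.eq_of_isDartColoring_int halt hconn hg a b) _,
      _, (x, 1), (y, 1), D.isDartColoring_colRedArc _, ?_⟩
    rw [Ne, D.colRedArc_eq_iff hloops]
    exact hcol

theorem not_isUnknot (D : LinkDiagram) (hne : Nonempty D.Crossing) (hloops : D.loops = 0)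
    (halt : D.Alternating) (hred : D.Reduced) (hconn : IsConnectedMap D.edge) : ¬ IsUnknot D := by
  intro h
  obtain ⟨A, _, _, g, a, b, hg, hab⟩ :=
    exists_nonconstant_isDartColoring _ D rfl hne hloops halt hred hconn
  exact hab (h.eq_of_isDartColoring hloops hg a b)

/-- A nonempty unsplit diagram has one piece. Were it a crossingless curve, it would be the circle,
an unknot. -/
theorem RepresentsPrimeLink.connected {D : LinkDiagram} (hD : D.RepresentsPrimeLink) :
    Nonempty D.Crossing ∧ D.loops = 0 ∧ IsConnectedMap D.edge := by
  have h1 := hD.nonempty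
  have h2 := hD.not_split D (Relation.EqvGen.refl D)
  unfold numPieces at h1 h2
  by_cases hne : Nonempty D.Crossing
  · have : Nonempty (CrossingPieces D.edge) := ⟨Quot.mk _ (Classical.arbitrary _)⟩
    have h3 : 0 < Nat.card (CrossingPieces D.edge) := Nat.card_pos
    exact ⟨hne, by omega, (isConnectedMap_iff D.edge_edge).2 (by omega)⟩
  · exfalso
    rw [not_nonempty_iff] at hne
    have : IsEmpty (CrossingPieces D.edge) := ⟨fun q => by
      obtain ⟨x, -⟩ := Quot.exists_rep q
      exact hne.elim x⟩
    have h3 : Nat.card (CrossingPieces D.edge) = 0 := Nat.card_of_isEmpty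
    have h4 : IsEmpty circle.Crossing := inferInstanceAs (IsEmpty Empty)
    have h5 : circle.loops = 1 := rfl
    exact hD.not_unknot (Relation.EqvGen.rel _ _ (Or.inl
      ⟨Equiv.equivOfIsEmpty _ _, fun _ => 0, fun _ => Or.inl rfl, fun x => hne.elim x,
        by rw [h5]; omega⟩))

/-- The two darts have the same color in every Fox coloring. -/
def Indistinguishable (D : LinkDiagram) (a b : Dart D.Crossing) : Prop :=
  ∀ (A : Type) [AddCommGroup A] (g : Dart D.Crossing → A), IsDartColoring D.edge g → g a = g b

/-- In a reduced alternating diagram of a prime link, Fox colorings distinguish all arcs. -/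
theorem RepresentsPrimeLink.arc_eq {D : LinkDiagram} (hD : D.RepresentsPrimeLink)
    (hred : D.Reduced) (halt : D.Alternating) {a b : Dart D.Crossing}
    (hab : D.Indistinguishable a b) : D.arc a = D.arc b := by
  obtain ⟨-, hloops, hconn⟩ := hD.connected
  by_contra hne
  obtain ⟨M, p, s, h⟩ := D.exists_isCut_of_colArc_eq halt hconn hne
    (hab _ _ D.isDartColoring_colArc)
  have hc := h.compl D.edge_edge halt
  -- Primeness makes one side of the cut an unknot, but both sides have nonconstant colorings.
  rcases hD.indecomposable _ _ _ _ _ _ (Relation.EqvGen.refl D)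
    (D.isSum_cutSummand h halt hconn hloops) with hu | hu
  · exact not_isUnknot (D.cutSummand h halt hconn) ⟨⟨p.1, h.left_mem⟩⟩ rfl (D.cutSummand_alternating h halt hconn)
      (D.cutSummand_reduced h halt hconn hred) (D.cutSummand_isConnectedMap h halt hconn) hu
  · exact not_isUnknot (D.cutSummand hc halt hconn) ⟨⟨_, hc.left_mem⟩⟩ rfl (D.cutSummand_alternating hc halt hconn)
      (D.cutSummand_reduced hc halt hconn hred) (D.cutSummand_isConnectedMap hc halt hconn) hu

/-! ### Arcs of a connected sum -/

theorem arc_eq_induction {D : LinkDiagram} {r : Dart D.Crossing → Dart D.Crossing → Prop}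
    (hr : Equivalence r) (hedge : ∀ d, r d (D.edge d)) (hover : ∀ x, r (x, 1) (x, 3))
    {a b : Dart D.Crossing} (hab : D.arc a = D.arc b) : r a b := by
  have h : Relation.EqvGen (ArcStep D) a b := Quot.eqvGen_exact (Sum.inl.inj hab)
  induction h with
  | rel a b h =>
    cases h
    · exact hedge _
    · exact hover _
  | refl => exact hr.refl _
  | symm _ _ _ ih => exact hr.symm (ih hab.symm)
  | trans a b c h₁ h₂ ih₁ ih₂ =>
    exact hr.trans (ih₁ (congrArg Sum.inl (Quot.eqvGen_sound h₁)))
      (ih₂ (congrArg Sum.inl (Quot.eqvGen_sound h₂)))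

theorem joinEquiv_equivalence (D : LinkDiagram) (J : Dart D.Crossing → Dart D.Crossing → Prop) :
    Equivalence (D.JoinEquiv J) := Relation.EqvGen.is_equivalence _

theorem JoinEquiv.of_arc_eq {D : LinkDiagram} (J : Dart D.Crossing → Dart D.Crossing → Prop)
    {x y : D.Arc} (h : x = y) : D.JoinEquiv J x y := by
  rw [h]; exact Relation.EqvGen.refl _

section Sum

variable {D₁ D₂ D : LinkDiagram} {h₁ : Dart D₁.Crossing} {h₂ : Dart D₂.Crossing}
  {f : D₁.Crossing ⊕ D₂.Crossing ≃ D.Crossing} {J : Dart D.Crossing → Dart D.Crossing → Prop}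

/-- An arc of `D₁` may be split by the attachment; its parts are then on the two joining arcs, which
`J` relates. -/
theorem IsSum.joinEquiv_left (hD : IsSum D₁ D₂ h₁ h₂ D f)
    (hJ : J (f (Sum.inl h₁.1), h₁.2) (f (Sum.inl (D₁.edge h₁).1), (D₁.edge h₁).2))
    {a b : Dart D₁.Crossing} (hab : D₁.arc a = D₁.arc b) :
    D.JoinEquiv J (D.arc (f (Sum.inl a.1), a.2)) (D.arc (f (Sum.inl b.1), b.2)) := by
  obtain ⟨e1, e2, e3, e4, -⟩ := hD
  dsimp only at e1 e2 e3 e4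
  have hE := D.joinEquiv_equivalence J
  have hjoin : D.JoinEquiv J (D.arc (f (Sum.inl h₁.1), h₁.2))
      (D.arc (f (Sum.inl (D₁.edge h₁).1), (D₁.edge h₁).2)) :=
    Relation.EqvGen.rel _ _ ⟨_, _, hJ, rfl, rfl⟩
  refine arc_eq_induction (r := fun a b => D.JoinEquiv J (D.arc (f (Sum.inl a.1), a.2))
    (D.arc (f (Sum.inl b.1), b.2))) ⟨fun _ => hE.refl _, hE.symm, hE.trans⟩ ?_ ?_ hab
  · intro d
    by_cases k1 : d = h₁
    · rw [k1]; exact hjoin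
    by_cases k2 : d = D₁.edge h₁
    · rw [k2, D₁.edge_edge]; exact hE.symm hjoin
    · rw [← e3 d k1 k2]; exact JoinEquiv.of_arc_eq J (D.arc_edge _).symm
  · exact fun x => JoinEquiv.of_arc_eq J (D.arc_over _)

theorem IsSum.joinEquiv_right (hD : IsSum D₁ D₂ h₁ h₂ D f)
    (hJ : J (f (Sum.inl h₁.1), h₁.2) (f (Sum.inl (D₁.edge h₁).1), (D₁.edge h₁).2))
    {a b : Dart D₂.Crossing} (hab : D₂.arc a = D₂.arc b) :
    D.JoinEquiv J (D.arc (f (Sum.inr a.1), a.2)) (D.arc (f (Sum.inr b.1), b.2)) := by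
  obtain ⟨e1, e2, e3, e4, -⟩ := hD
  dsimp only at e1 e2 e3 e4
  have hE := D.joinEquiv_equivalence J
  have hjoin : D.JoinEquiv J (D.arc (f (Sum.inr h₂.1), h₂.2))
      (D.arc (f (Sum.inr (D₂.edge h₂).1), (D₂.edge h₂).2)) := by
    rw [← e1, ← e2, D.arc_edge, D.arc_edge]
    exact Relation.EqvGen.rel _ _ ⟨_, _, hJ, rfl, rfl⟩
  refine arc_eq_induction (r := fun a b => D.JoinEquiv J (D.arc (f (Sum.inr a.1), a.2))
    (D.arc (f (Sum.inr b.1), b.2))) ⟨fun _ => hE.refl _, hE.symm, hE.trans⟩ ?_ ?_ hab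
  · intro d
    by_cases k1 : d = h₂
    · rw [k1]; exact hjoin
    by_cases k2 : d = D₂.edge h₂
    · rw [k2, D₂.edge_edge]; exact hE.symm hjoin
    · rw [← e4 d k1 k2]; exact JoinEquiv.of_arc_eq J (D.arc_edge _).symm
  · exact fun x => JoinEquiv.of_arc_eq J (D.arc_over _)

theorem IsSum.joinEquiv_of_joinEquiv (hD : IsSum D₁ D₂ h₁ h₂ D f)
    (hJ : J (f (Sum.inl h₁.1), h₁.2) (f (Sum.inl (D₁.edge h₁).1), (D₁.edge h₁).2))
    (hloops : D₁.loops = 0) {J₁ : Dart D₁.Crossing → Dart D₁.Crossing → Prop}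
    (hJ₁ : ∀ a b, J₁ a b → J (f (Sum.inl a.1), a.2) (f (Sum.inl b.1), b.2))
    {a b : Dart D₁.Crossing} (hab : D₁.JoinEquiv J₁ (D₁.arc a) (D₁.arc b)) :
    D.JoinEquiv J (D.arc (f (Sum.inl a.1), a.2)) (D.arc (f (Sum.inl b.1), b.2)) := by
  have hE := D.joinEquiv_equivalence J
  -- Quantifying over all representing darts is needed for the induction, since an arc of `D₁` does
  -- not determine an arc of `D`.
  have key : ∀ x y, D₁.JoinEquiv J₁ x y → ∀ a b, D₁.arc a = x → D₁.arc b = y →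
      D.JoinEquiv J (D.arc (f (Sum.inl a.1), a.2)) (D.arc (f (Sum.inl b.1), b.2)) := by
    intro x y hxy
    induction hxy with
    | rel x y h =>
      obtain ⟨a₀, b₀, h₀, rfl, rfl⟩ := h
      intro a b ha hb
      exact hE.trans (hD.joinEquiv_left hJ ha) (hE.trans
        (Relation.EqvGen.rel _ _ ⟨_, _, hJ₁ _ _ h₀, rfl, rfl⟩) (hD.joinEquiv_left hJ hb.symm))
    | refl x =>
      intro a b ha hb
      exact hD.joinEquiv_left hJ (ha.trans hb.symm)
    | symm x y _ ih => exact fun a b ha hb => hE.symm (ih b a hb ha)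
    | trans x y z _ _ ih₁ ih₂ =>
      intro a b ha hb
      obtain ⟨c, hc⟩ := D₁.exists_arc_eq hloops y
      exact hE.trans (ih₁ a c ha hc) (ih₂ c b hc hb)
  exact key _ _ hab a b rfl rfl

end Sum

/-- The Fox colorings of a connected sum of reduced alternating diagrams of prime links. -/
theorem IsConnectedSum.colorings {L : List LinkDiagram} {D : LinkDiagram}
    {J : Dart D.Crossing → Dart D.Crossing → Prop} (hD : IsConnectedSum L D J)
    (hL : ∀ E ∈ L, E.Reduced ∧ E.Alternating ∧ E.RepresentsPrimeLink) :
    D.loops = 0 ∧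
    (∀ g : Dart D.Crossing → ℤ, IsDartColoring D.edge g → ∀ a b, g a = g b) ∧
    (∃ a b, ¬ D.Indistinguishable a b) ∧
    ∀ a b, D.Indistinguishable a b → D.JoinEquiv J (D.arc a) (D.arc b) := by
  induction hD with
  | single D =>
    obtain ⟨hred, halt, hprime⟩ := hL D (List.mem_singleton_self D)
    obtain ⟨hne, hloops, hconn⟩ := hprime.connected
    refine ⟨hloops, fun g hg a b => D.eq_of_isDartColoring_int halt hconn hg a b, ?_,
      fun a b hab => JoinEquiv.of_arc_eq _ (hprime.arc_eq hred halt hab)⟩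
    obtain ⟨x, y, hxy⟩ := (D.nontrivial_crossing halt hred).exists_pair_ne
    exact ⟨(x, 1), (y, 1), fun h => D.arc_one_ne halt hxy (hprime.arc_eq hred halt h)⟩
  | @sum L D₁ J₁ hL₁ D₂ h₁ h₂ D f hsum ih =>
    obtain ⟨loops₁, const₁, ⟨a₀, b₀, hab₀⟩, sep₁⟩ :=
      ih fun E hE => hL E (List.mem_append_left _ hE)
    obtain ⟨hred, halt, hprime⟩ := hL D₂ (List.mem_append_right _ (List.mem_singleton_self D₂))
    obtain ⟨hne, loops₂, hconn⟩ := hprime.connected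
    -- Extension by a constant over the other summand turns colorings of one summand into colorings
    -- of the sum.
    have indist₁ : ∀ a b : Dart D₁.Crossing,
        D.Indistinguishable (f (Sum.inl a.1), a.2) (f (Sum.inl b.1), b.2) →
        D₁.Indistinguishable a b := by
      intro a b hab A _ g hg
      obtain ⟨G, hG, hGl, -⟩ := hsum.exists_isDartColoring hg
        (isDartColoring_const D₂.edge (g h₁)) rfl
      rw [← hGl, ← hGl]; exact hab A G hG
    have indist₂ : ∀ a b : Dart D₂.Crossing,
        D.Indistinguishable (f (Sum.inr a.1), a.2) (f (Sum.inr b.1), b.2) →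
        D₂.Indistinguishable a b := by
      intro a b hab A _ g hg
      obtain ⟨G, hG, -, hGr⟩ := hsum.exists_isDartColoring
        (isDartColoring_const D₁.edge (g h₂)) hg rfl
      rw [← hGr, ← hGr]; exact hab A G hG
    -- For darts on different sides, either extension gives one of them the color of the cut edge.
    have indist₁₂ : ∀ (a : Dart D₁.Crossing) (b : Dart D₂.Crossing),
        D.Indistinguishable (f (Sum.inl a.1), a.2) (f (Sum.inr b.1), b.2) →
        D₁.Indistinguishable a h₁ ∧ D₂.Indistinguishable h₂ b := by
      intro a b hab
      constructor
      · intro A _ g hg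
        obtain ⟨G, hG, hGl, hGr⟩ := hsum.exists_isDartColoring hg
          (isDartColoring_const D₂.edge (g h₁)) rfl
        rw [← hGl, hab A G hG, hGr]
      · intro A _ g hg
        obtain ⟨G, hG, hGl, hGr⟩ := hsum.exists_isDartColoring
          (isDartColoring_const D₁.edge (g h₂)) hg rfl
        rw [← hGr b, ← hab A G hG, hGl]
    have hcut := hsum
    obtain ⟨e1, -, -, -, hloops⟩ := hcut
    dsimp only at e1
    refine ⟨by rw [hloops, loops₁, loops₂], ?_, ?_, ?_⟩
    -- Both restrictions are constant, with the common color of the joining edge.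
    · intro g hg
      obtain ⟨hg₁, hg₂⟩ := hsum.isDartColoring_restrict halt hg
      have k := hg.edge_eq (f (Sum.inl h₁.1), h₁.2)
      rw [e1] at k
      have key : ∀ d, g d = g (f (Sum.inl h₁.1), h₁.2) := by
        intro d
        rcases sum_dart_cases f d with ⟨m, rfl⟩ | ⟨m, rfl⟩
        · exact const₁ _ hg₁ m h₁
        · exact (D₂.eq_of_isDartColoring_int halt hconn hg₂ m h₂).trans k
      exact fun a b => (key a).trans (key b).symm
    · exact ⟨_, _, fun h => hab₀ (indist₁ a₀ b₀ h)⟩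
    · set J : Dart D.Crossing → Dart D.Crossing → Prop := fun a b => ∃ a₁ b₁ : Dart D₁.Crossing,
        (J₁ a₁ b₁ ∨ (a₁ = h₁ ∧ b₁ = D₁.edge h₁)) ∧
        a = (f (Sum.inl a₁.1), a₁.2) ∧ b = (f (Sum.inl b₁.1), b₁.2)
      have hJ : J (f (Sum.inl h₁.1), h₁.2) (f (Sum.inl (D₁.edge h₁).1), (D₁.edge h₁).2) :=
        ⟨_, _, Or.inr ⟨rfl, rfl⟩, rfl, rfl⟩
      have hJ₁ : ∀ a b, J₁ a b → J (f (Sum.inl a.1), a.2) (f (Sum.inl b.1), b.2) :=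
        fun a b h => ⟨a, b, Or.inl h, rfl, rfl⟩
      have hE := D.joinEquiv_equivalence J
      have hmixed : ∀ (a : Dart D₁.Crossing) (b : Dart D₂.Crossing),
          D₁.Indistinguishable a h₁ ∧ D₂.Indistinguishable h₂ b →
          D.JoinEquiv J (D.arc (f (Sum.inl a.1), a.2)) (D.arc (f (Sum.inr b.1), b.2)) := by
        rintro a b ⟨ha, hb⟩
        have hleft := hsum.joinEquiv_of_joinEquiv hJ loops₁ hJ₁ (sep₁ a h₁ ha)
        rw [← D.arc_edge (f (Sum.inl h₁.1), h₁.2), e1] at hleft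
        exact hE.trans hleft (hsum.joinEquiv_right hJ (hprime.arc_eq hred halt hb))
      intro a b hab
      rcases sum_dart_cases f a with ⟨a, rfl⟩ | ⟨a, rfl⟩ <;>
        rcases sum_dart_cases f b with ⟨b, rfl⟩ | ⟨b, rfl⟩
      · exact hsum.joinEquiv_of_joinEquiv hJ loops₁ hJ₁ (sep₁ a b (indist₁ a b hab))
      · exact hmixed a b (indist₁₂ a b hab)
      · exact hE.symm (hmixed b a (indist₁₂ b a fun A _ g hg => (hab A g hg).symm))
      · exact hsum.joinEquiv_right hJ (hprime.arc_eq hred halt (indist₂ a b hab))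

/-! ### From the reduced group to Fox colorings modulo n_1. -/

theorem Indistinguishable.of_colArc_eq {D : LinkDiagram} {a b : Dart D.Crossing}
    (h : D.colArc (D.arc a) = D.colArc (D.arc b)) : D.Indistinguishable a b := by
  intro A _ g hg
  obtain ⟨φ, hφ⟩ := D.exists_hom_of_isDartColoring hg
  rw [← hφ, ← hφ, h]

theorem isFoxColoring_comp_colRedArc (D : LinkDiagram) (base : D.Arc) {k : ℕ}
    (φ : D.ColRed base →+ ZMod k) : D.IsFoxColoring k fun x => φ (D.colRedArc base x) := by
  intro x
  have := (((D.isDartColoring_colRedArc base).comp φ).crossing x).2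
  dsimp only at this
  rw [sub_sub, this, two_mul, sub_self]

end LinkDiagram

/-- Multiplication by `n / m`, which is nonzero because `n` is positive. -/
theorem exists_injective_zmod_hom {m n : ℕ} (hn : 0 < n) (h : m ∣ n) :
    ∃ φ : ZMod m →+ ZMod n, Function.Injective φ := by
  obtain ⟨q, rfl⟩ := h
  have hq : (q : ℤ) ≠ 0 := by
    rintro h; simp only [Nat.cast_eq_zero] at h; subst h; simp at hn
  refine ⟨ZMod.lift m ⟨zmultiplesHom (ZMod (m * q)) (q : ZMod (m * q)), ?_⟩, ?_⟩
  · rw [zmultiplesHom_apply, zsmul_eq_mul, Int.cast_natCast, ← Nat.cast_mul, ZMod.natCast_self]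
  · rw [ZMod.lift_injective]
    intro j hj
    change (zmultiplesHom (ZMod (m * q)) (q : ZMod (m * q))) j = 0 at hj
    rw [zmultiplesHom_apply, zsmul_eq_mul, ← Int.cast_natCast (R := ZMod (m * q)) q,
      ← Int.cast_mul, ZMod.intCast_zmod_eq_zero_iff_dvd] at hj
    rw [ZMod.intCast_zmod_eq_zero_iff_dvd]
    push_cast at hj
    exact Int.dvd_of_mul_dvd_mul_right hq hj

theorem theorem4p2 (summands : List LinkDiagram) (D : LinkDiagram)
    (J : Dart D.Crossing → Dart D.Crossing → Prop)
    (hD : LinkDiagram.IsConnectedSum summands D J)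
    (hsummands : ∀ E ∈ summands, E.Reduced ∧ E.Alternating ∧ E.RepresentsPrimeLink)
    (base : D.Arc) :
    Finite (D.ColRed base) ∧
    ∀ (s : ℕ) (n : Fin s → ℕ), (∀ i, 1 < n i) → (∀ i j, i ≤ j → n j ∣ n i) →
      Nonempty (D.ColRed base ≃+ ((i : Fin s) → ZMod (n i))) →
      ∃ hs : 0 < s,
        (∀ x y : D.Arc, ¬ D.JoinEquiv J x y →
          ∃ f : D.Arc → ZMod (n ⟨0, hs⟩), D.IsFoxColoring (n ⟨0, hs⟩) f ∧ f x ≠ f y) ∧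
        ∃ t : ℕ, t ≤ s ∧ ∃ f : Fin t → D.Arc → ZMod (n ⟨0, hs⟩),
          (∀ k, D.IsFoxColoring (n ⟨0, hs⟩) (f k)) ∧
          ∀ x y : D.Arc, ¬ D.JoinEquiv J x y → ∃ k, f k x ≠ f k y := by
  obtain ⟨hloops, hconst, ⟨a, b, hab⟩, hsep⟩ := hD.colorings hsummands
  refine ⟨D.finite_colRed hloops hconst base, fun s n hn hdvd ⟨e⟩ => ?_⟩
  -- An empty sum would make `ColRed` trivial and all darts indistinguishable.
  have hs : 0 < s := by
    rw [Nat.pos_iff_ne_zero]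
    rintro rfl
    refine hab (LinkDiagram.Indistinguishable.of_colArc_eq
      ((D.colRedArc_eq_iff hloops base _ _).1 (e.injective (funext fun i => i.elim0))))
  have hfam : ∃ f : Fin s → D.Arc → ZMod (n ⟨0, hs⟩),
      (∀ k, D.IsFoxColoring (n ⟨0, hs⟩) (f k)) ∧
      ∀ x y : D.Arc, ¬ D.JoinEquiv J x y → ∃ k, f k x ≠ f k y := by
    have hφ : ∀ k, ∃ φ : ZMod (n k) →+ ZMod (n ⟨0, hs⟩), Function.Injective φ := fun k =>
      exists_injective_zmod_hom (zero_lt_one.trans (hn _))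
        (hdvd _ _ (Nat.zero_le _))
    choose φ hφ using hφ
    -- The k-th coloring is the k-th coordinate of the class of the arc, embedded in the largest
    -- cyclic summand. Together the coordinates determine the class.
    refine ⟨fun k x => φ k (e (D.colRedArc base x) k), fun k => ?_, fun x y hxy => ?_⟩
    · exact D.isFoxColoring_comp_colRedArc base
        ((φ k).comp ((Pi.evalAddMonoidHom (fun i => ZMod (n i)) k).comp e.toAddMonoidHom))
    · by_contra hcon
      push Not at hcon
      obtain ⟨a, rfl⟩ := D.exists_arc_eq hloops x
      obtain ⟨b, rfl⟩ := D.exists_arc_eq hloops y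
      exact hxy (hsep a b (LinkDiagram.Indistinguishable.of_colArc_eq
        ((D.colRedArc_eq_iff hloops base _ _).1
          (e.injective (funext fun k => hφ k (hcon k))))))
  obtain ⟨f, hf, hf'⟩ := hfam
  -- One member of the separating family proves (a); the whole family, with `t = s`, proves (b).
  refine ⟨hs, fun x y hxy => ?_, s, le_rfl, f, hf, hf'⟩
  obtain ⟨k, hk⟩ := hf' x y hxy
  exact ⟨f k, hf k, hk⟩
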